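/- **Setting.** Let $N\ge 1$, $[N]=\{1,\dots,N\}$, and let $\mathcal B_N$ be the free Boolean algebra generated by $x_1,\dots,x_N$, with greatest element $X$, least element $\emptyset$, complement $\bar f$ and $f\setminus g=f\cap\bar g$. For $I\subseteq[N]$ put $a_I=(\bigcap_{j\notin I}x_j)\setminus(\bigcup_{i\in I}x_i)$ and $u_I=\bigcup_{i\in I}x_i$. Let $\mathcal C_N\subseteq\mathcal B_N$ be the set of elements that can be built from $x_1,\dots,x_N$ with $\cup,\cap,\setminus$ only. For $f\in\mathcal C_N$ let $(m_{f,I})_{\emptyset\ne I\subseteq[N]}$ be the unique integers such that $\mu(f)=\sum_{\emptyset\ne I\subseteq[N]}m_{f,I}\,\mu(u_I)$ for every $\mu\colon\mathcal C_N\to\mathbb R$ satisfying $\mu(g\cup h)=\mu(g)+\mu(h)$ whenever $g\cap h=\emptyset$. Let $\kappa_d$ be the volume of the unit ball of $\mathbb R^d$. For a non-empty compact convex set $K\subset\mathbb R^d$ the quermassintegrals $W^d_k(K)$ and the intrinsic volumes $V_k(K)$ are the coefficients in Steiner's formula $$\mathrm{vol}_d(K+B^d(\mathbf 0,r))=\sum_{k=0}^d\binom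 dk W^d_k(K)r^k=\sum_{k=0}^d\kappa_{d-k}V_k(K)r^{d-k}\qquad(r\ge 0),$$ and $W^d_k(K)=V_k(K)=0$ for $k>d$. For $\mathbf p=(\mathbf p_1,\dots,\mathbf p_N)\in(\mathbb R^d)^N$ and $\emptyset\ne I\subseteq[N]$ let $K_I(\mathbf p)$ be the convex hull of $\{\mathbf p_i\mid i\in I\}$. For $f\in\mathcal C_N$ put $$W^d_{f,k}(\mathbf p)=\sum_{\emptyset\neq I\subseteq[N]}m_{f,I}W^d_k(K_I(\mathbf p)),\qquad V_{f,k}(\mathbf p)=\sum_{\emptyset\neq I\subseteq[N]}m_{f,I}V_k(K_I(\mathbf p)),$$ and extend both, as functions of $f$, to $\mathcal B_N$ as the unique function $\nu\colon\mathcal B_N\to\mathbb R$ with the given values on $\mathcal C_N$ such that $\nu(f\cup g)=\nu(f)+\nu(g)-\nu(f\cap g)$ for all $f,g$ and $\nu(X)=0$. **Proposition.** (a) For every $f\in\mathcal B_N$, $V_{f,0}(\mathbf p)$ does not depend on $\mathbf p$. If $f\in\mathcal C_N$, its value $V_{f,0}\equiv\sum_{\emptyset\ne I\subseteq[N]}m_{f,I}$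 is $1$ if $a_\emptyset\subseteq f$, and $0$ otherwise. If $f\notin\mathcal C_N$, its value is $0$ if $a_\emptyset\subseteq f$, and $-1$ otherwise. (b) For every $f\in\mathcal B_N$ and $k\ge 0$, $V_{f,k}(\mathbf p)$ does not depend on the dimension of the ambient space: $V_{f,k}(\Phi(\mathbf p_1),\dots,\Phi(\mathbf p_N))=V_{f,k}(\mathbf p)$ for every isometric embedding $\Phi\colon\mathbb R^d\to\mathbb R^{d'}$. In particular, for $0\le k\le d$ and $s\in\mathbb N$, $$W_{f,k}^d=\frac{\kappa_{k}}{\binom{d}{k}}V_{f,d-k}=\frac{\kappa_{k}}{\binom{d}{k}}V_{f,(d+s)-(k+s)}=\frac{\binom{d+s}{k+s}\kappa_{k}}{\binom{d}{k}\kappa_{k+s}}W^{d+s}_{f,k+s}=\frac{(d+1)\cdots(d+s)\,\kappa_{k}}{(k+1)\cdots(k+s)\,\kappa_{k+s}}W^{d+s}_{f,k+s},$$ where the first two expressions are evaluated at $\mathbf p\in(\mathbb R^d)^N$ and the other three at the image of $\mathbf p$ under an arbitrary isometric embedding $\mathbb R^d\to\mathbb R^{d+s}$. (c) For every $f\in\mathcal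 B_N$ and $k\ge0$, $V_{f,k}$ is a continuous function on $(\mathbb R^d)^N$ for every $d$. (d) If $f,g\in\mathcal B_N$ and $f\cap g=\emptyset$, then $W^d_{f\cup g,k}=W^d_{f,k}+W^d_{g,k}$ and $V_{f\cup g,k}=V_{f,k}+V_{g,k}$. (e) $W^d_{\bar f,k}=-W^d_{f,k}$ and $V_{\bar f,k}=-V_{f,k}$ for every $f\in\mathcal B_N$. -/

import Mathlib

open MeasureTheory Set
open scoped Pointwise

/-! ## The free Boolean algebra on `x_1, …, x_N` -/

/-- The free Boolean algebra on `N` generators, realized by truth tables: an element is a set of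
truth assignments, and a truth assignment is recorded by the set `T` of the variables that are true.
Joins, meets, complements, differences and the order are the set-theoretic ones; the greatest element
is `univ` and the least one is `∅`. Freeness is proved in `FreeBoolAlg.isFree`. -/
abbrev FreeBoolAlg (N : ℕ) : Type := Set (Finset (Fin N))

namespace FreeBoolAlg

variable {N : ℕ}

/-- The generator `x_i`. -/
def var (i : Fin N) : FreeBoolAlg N := {T | i ∈ T}

/-- The atomic element `a_I = (⋂_{j ∉ I} x_j) \ (⋃_{i ∈ I} x_i)`. -/
def atom (I : Finset (Fin N)) : FreeBoolAlg N :=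
  (⋂ j ∈ {j : Fin N | j ∉ I}, var j) \ (⋃ i ∈ I, var i)

/-- The union `u_I = ⋃_{i ∈ I} x_i`. -/
def unionVar (I : Finset (Fin N)) : FreeBoolAlg N := ⋃ i ∈ I, var i

/-- `InC f` says that `f` belongs to `C_N`: it can be built from the variables using only
`∪`, `∩` and `\`. -/
inductive InC : FreeBoolAlg N → Prop
  | var (i : Fin N) : InC (var i)
  | union {f g : FreeBoolAlg N} : InC f → InC g → InC (f ∪ g)
  | inter {f g : FreeBoolAlg N} : InC f → InC g → InC (f ∩ g)
  | sdiff {f g : FreeBoolAlg N} : InC f → InC g → InC (f \ g)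

/-- Additivity on `C_N`. Only the values of `μ` on `C_N` matter, so the functions with this property,
restricted to `C_N`, are exactly the elements of the space `M_N`. -/
def AdditiveOnC (μ : FreeBoolAlg N → ℝ) : Prop :=
  ∀ f g : FreeBoolAlg N, InC f → InC g → f ∩ g = ∅ → μ (f ∪ g) = μ f + μ g

/-- The non-empty subsets of `[N]`. -/
abbrev NonemptySub (N : ℕ) : Type := {I : Finset (Fin N) // I.Nonempty}

/-- `m` is a family of integers with `μ(f) = ∑_{∅ ≠ I ⊆ [N]} m_I μ(u_I)` for all `μ ∈ M_N`. -/
def IsUnionCoeff (f : FreeBoolAlg N) (m : NonemptySub N → ℤ) : Prop :=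
  ∀ μ : FreeBoolAlg N → ℝ, AdditiveOnC μ →
    μ f = ∑ I : NonemptySub N, (m I : ℝ) * μ (unionVar I.1)

/-- The coefficients `m_{f,I}`: for `f ∈ C_N` the unique family with `IsUnionCoeff f`
(existence and uniqueness are `existsUnique_unionCoeff`). -/
noncomputable def unionCoeff (f : FreeBoolAlg N) : NonemptySub N → ℤ :=
  Classical.epsilon (IsUnionCoeff f)

/-- `ν` is a `0`-weight extension of (the restriction to `C_N` of) `μ`. -/
def IsZeroWeightExt (μ ν : FreeBoolAlg N → ℝ) : Prop :=
  (∀ f, InC f → ν f = μ f) ∧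
    (∀ f g : FreeBoolAlg N, ν (f ∪ g) = ν f + ν g - ν (f ∩ g)) ∧ ν univ = 0

/-- The `0`-weight extension of `μ` (it exists and is unique when `N ≥ 1` and `μ` is additive on
`C_N`, see `existsUnique_zeroWeightExt`). -/
noncomputable def zeroWeightExt (μ : FreeBoolAlg N → ℝ) : FreeBoolAlg N → ℝ :=
  Classical.epsilon (IsZeroWeightExt μ)

/-! ### The definitions above are meaningful -/

/-- `FreeBoolAlg N` is free on the generators `x_1, …, x_N`. -/
theorem isFree {B : Type*} [BooleanAlgebra B] (y : Fin N → B) :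
    ∃! φ : BoundedLatticeHom (FreeBoolAlg N) B, ∀ i, φ (var i) = y i := by
  classical
  let t : Finset (Fin N) → Finset (Fin N) → B := fun s T => T.inf y ⊓ (s \ T).inf fun i => (y i)ᶜ
  have htop : ∀ s : Finset (Fin N), s.powerset.sup (t s) = ⊤ := by
    intro s
    induction s using Finset.induction_on with
    | empty => simp [t]
    | insert a s ha ih =>
      have h1 : s.powerset.sup (t (insert a s)) = s.powerset.sup (fun T => (y a)ᶜ ⊓ t s T) := by
        refine Finset.sup_congr rfl fun T hT => ?_
        have haT : a ∉ T := fun h => ha (Finset.mem_powerset.1 hT h)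
        simp only [t, Finset.insert_sdiff_of_notMem _ haT, Finset.inf_insert]
        rw [inf_left_comm]
      have h2 : s.powerset.sup (t (insert a s) ∘ insert a) =
          s.powerset.sup (fun T => y a ⊓ t s T) := by
        refine Finset.sup_congr rfl fun T hT => ?_
        have : insert a s \ insert a T = s \ T := by
          rw [Finset.insert_sdiff_insert, Finset.sdiff_insert_of_notMem ha]
        simp only [t, Function.comp_apply, this, Finset.inf_insert, inf_assoc]
      rw [Finset.powerset_insert, Finset.sup_union, Finset.sup_image, h1, h2,
        ← Finset.sup_inf_distrib_left, ← Finset.sup_inf_distrib_left, ih]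
      simp
  let e : Finset (Fin N) → B := fun T => t Finset.univ T
  have he : (Finset.univ : Finset (Finset (Fin N))).sup e = ⊤ := by
    simpa using htop Finset.univ
  have hpos : ∀ {T : Finset (Fin N)} {i}, i ∈ T → e T ≤ y i := fun h =>
    inf_le_left.trans (Finset.inf_le h)
  have hneg : ∀ {T : Finset (Fin N)} {i}, i ∉ T → e T ≤ (y i)ᶜ := fun {T i} h =>
    inf_le_right.trans (Finset.inf_le (f := fun i => (y i)ᶜ) (by simpa using h))
  have hdisj : ∀ {S T : Finset (Fin N)}, S ≠ T → e S ⊓ e T = ⊥ := by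
    intro S T hST
    rw [← le_bot_iff]
    by_contra hb
    refine hST (Finset.ext fun i => ⟨fun hi => ?_, fun hi => ?_⟩)
    · by_contra hi'
      exact hb ((inf_le_inf (hpos hi) (hneg hi')).trans (by simp))
    · by_contra hi'
      exact hb ((inf_le_inf (hneg hi') (hpos hi)).trans (by simp))
  let Φ : FreeBoolAlg N → B := fun f =>
    (Finset.univ : Finset (Finset (Fin N))).sup fun T => if T ∈ f then e T else ⊥
  have hle : ∀ {f : FreeBoolAlg N} {T}, T ∈ f → e T ≤ Φ f := by
    intro f T hT
    have := Finset.le_sup (f := fun T => if T ∈ f then e T else ⊥) (Finset.mem_univ T)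
    simpa [hT] using this
  have hsup : ∀ {f : FreeBoolAlg N} {b : B}, (∀ T ∈ f, e T ≤ b) → Φ f ≤ b := by
    intro f b h
    refine Finset.sup_le fun T _ => ?_
    by_cases hT : T ∈ f
    · simpa [hT] using h T hT
    · simp [hT]
  have hmono : ∀ {f g : FreeBoolAlg N}, f ⊆ g → Φ f ≤ Φ g := fun h =>
    hsup fun T hT => hle (h hT)
  have hinf : ∀ {f : FreeBoolAlg N} {T}, T ∉ f → e T ⊓ Φ f = ⊥ := by
    intro f T hT
    rw [← disjoint_iff, disjoint_comm, ← le_compl_iff_disjoint_right]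
    refine hsup fun S hS => ?_
    rw [le_compl_iff_disjoint_right, disjoint_iff]
    exact hdisj fun h => hT (h ▸ hS)
  have hvar : ∀ i, Φ (var i) = y i := by
    intro i
    refine le_antisymm (hsup fun T hT => hpos hT) ?_
    rw [← inf_top_eq (y i), ← he, Finset.sup_inf_distrib_left]
    refine Finset.sup_le fun T _ => ?_
    by_cases hT : i ∈ T
    · exact inf_le_right.trans (hle hT)
    · exact (inf_le_inf_left _ (hneg hT)).trans (by simp)
  refine ⟨⟨⟨⟨Φ, fun f g => ?_⟩, fun f g => ?_⟩, ?_, ?_⟩, hvar, ?_⟩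
  · refine le_antisymm (hsup fun T hT => ?_)
      (sup_le (hmono subset_union_left) (hmono subset_union_right))
    rcases hT with hT | hT
    · exact (hle hT).trans le_sup_left
    · exact (hle hT).trans le_sup_right
  · refine le_antisymm (le_inf (hmono inter_subset_left) (hmono inter_subset_right)) ?_
    rw [← le_himp_iff]
    refine hsup fun T hT => ?_
    rw [le_himp_iff]
    by_cases hT' : T ∈ g
    · exact inf_le_left.trans (hle ⟨hT, hT'⟩)
    · rw [hinf hT']
      exact bot_le
  · refine top_le_iff.1 ?_
    rw [← he]
    exact Finset.sup_le fun T _ => hle (mem_univ T)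
  · exact le_bot_iff.1 (hsup fun T hT => hT.elim)
  · intro ψ hψ
    generalize hχ : (⟨⟨⟨Φ, _⟩, _⟩, _, _⟩ : BoundedLatticeHom (FreeBoolAlg N) B) = χ
    have hχv : ∀ i, χ (var i) = y i := by
      subst hχ
      exact hvar
    have hsing : ∀ (θ : BoundedLatticeHom (FreeBoolAlg N) B), (∀ i, θ (var i) = y i) →
        ∀ T, θ {T} = e T := by
      intro θ hθ T
      have : ({T} : FreeBoolAlg N) = T.inf var ⊓ (Finset.univ \ T).inf fun i => (var i)ᶜ := by
        ext S
        simp only [Finset.inf_eq_iInf, inf_eq_inter, iInf_eq_iInter, mem_inter_iff, mem_iInter,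
          mem_compl_iff, var, mem_ofPred_eq, mem_singleton_iff, Finset.mem_sdiff, Finset.mem_univ,
          true_and, Finset.ext_iff]
        exact ⟨fun h => ⟨fun i => (h i).2, fun i hi hi' => hi ((h i).1 hi')⟩,
          fun h i => ⟨fun hi => by_contra fun hi' => h.2 i hi' hi, h.1 i⟩⟩
      rw [this, map_inf, map_finset_inf, map_finset_inf]
      simp only [e, t, Function.comp_def, map_compl', hθ]
    refine DFunLike.ext _ _ fun f => ?_
    induction f, f.toFinite using Set.Finite.induction_on with
    | empty =>
      exact (map_bot ψ).trans (map_bot χ).symm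
    | @insert T s _ _ ih =>
      have hu : (insert T s : FreeBoolAlg N) = {T} ⊔ s := insert_eq T s
      rw [hu, map_sup, map_sup, ih, hsing ψ hψ, hsing χ hχv]

theorem mem_atom {I T : Finset (Fin N)} : T ∈ atom I ↔ T = Iᶜ := by
  simp only [atom, var, mem_sdiff, mem_iInter, mem_iUnion, mem_ofPred_eq, exists_prop, not_exists,
    not_and, Finset.ext_iff, Finset.mem_compl]
  constructor
  · rintro ⟨h1, h2⟩ i
    exact ⟨fun hT hI => h2 i hI hT, h1 i⟩
  · intro h
    exact ⟨fun i => (h i).2, fun i hI hT => (h i).1 hT hI⟩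

theorem mem_unionVar {I T : Finset (Fin N)} : T ∈ unionVar I ↔ ¬ Disjoint I T := by
  simp [unionVar, var, Finset.not_disjoint_iff]

theorem empty_notMem_of_inC {f : FreeBoolAlg N} (hf : InC f) : (∅ : Finset (Fin N)) ∉ f := by
  induction hf with
  | var i => simp [var]
  | union _ _ h1 h2 => simp [h1, h2]
  | inter _ _ h1 _ => simp [h1]
  | sdiff _ _ h1 _ => simp [h1]

theorem inC_empty (hN : 1 ≤ N) : InC (∅ : FreeBoolAlg N) := by
  have h := InC.var (⟨0, hN⟩ : Fin N)
  simpa using h.sdiff h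

theorem inC_singleton {T : Finset (Fin N)} (hT : T.Nonempty) : InC ({T} : FreeBoolAlg N) := by
  obtain ⟨i₀, h₀⟩ := hT
  have key : ∀ s : Finset (Fin N),
      InC {S : Finset (Fin N) | i₀ ∈ S ∧ ∀ j ∈ s, (j ∈ S ↔ j ∈ T)} := by
    intro s
    induction s using Finset.induction_on with
    | empty => simpa [var] using InC.var i₀
    | insert a s _ ih =>
      by_cases haT : a ∈ T
      · convert ih.inter (InC.var a) using 1
        ext S
        simp only [Finset.forall_mem_insert, mem_ofPred_eq, mem_inter_iff, var]
        tauto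
      · convert ih.sdiff (InC.var a) using 1
        ext S
        simp only [Finset.forall_mem_insert, mem_ofPred_eq, mem_sdiff, var]
        tauto
  convert key Finset.univ using 1
  ext S
  simp only [mem_singleton_iff, Finset.mem_univ, true_imp_iff, mem_ofPred_eq]
  constructor
  · rintro rfl
    exact ⟨h₀, fun j => Iff.rfl⟩
  · rintro ⟨-, h⟩
    exact Finset.ext h

theorem inC_of_empty_notMem (hN : 1 ≤ N) {f : FreeBoolAlg N}
    (hf : (∅ : Finset (Fin N)) ∉ f) : InC f := by
  induction f, f.toFinite using Set.Finite.induction_on with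
  | empty => exact inC_empty hN
  | @insert T s _ _ ih =>
    rw [insert_eq]
    refine (inC_singleton ?_).union (ih fun h => hf (Or.inr h))
    rw [Finset.nonempty_iff_ne_empty]
    rintro rfl
    exact hf (Or.inl rfl)

theorem inC_iff (hN : 1 ≤ N) {f : FreeBoolAlg N} :
    InC f ↔ ¬ atom Finset.univ ⊆ f := by
  have : atom Finset.univ ⊆ f ↔ (∅ : Finset (Fin N)) ∈ f := by
    constructor
    · intro h
      exact h (mem_atom.2 (by simp))
    · intro h T hT
      rw [mem_atom] at hT
      simpa [hT] using h
  rw [this]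
  exact ⟨empty_notMem_of_inC, inC_of_empty_notMem hN⟩

theorem additive_eq_sum (hN : 1 ≤ N) {μ : FreeBoolAlg N → ℝ} (hμ : AdditiveOnC μ)
    {f : FreeBoolAlg N} (hf : (∅ : Finset (Fin N)) ∉ f) :
    μ f = ∑ T : Finset (Fin N), f.indicator (fun T => μ {T}) T := by
  have h0 : μ ∅ = 0 := by
    have := hμ ∅ ∅ (inC_empty hN) (inC_empty hN) (by simp)
    rw [union_self] at this
    linarith
  induction f, f.toFinite using Set.Finite.induction_on with
  | empty => simp [h0]
  | @insert T s hT _ ih =>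
    have hs : (∅ : Finset (Fin N)) ∉ s := fun h => hf (Or.inr h)
    have hT' : (∅ : Finset (Fin N)) ∉ ({T} : FreeBoolAlg N) := fun h => hf (Or.inl h)
    have hd : ({T} : FreeBoolAlg N) ∩ s = ∅ := by
      ext S
      simp only [mem_inter_iff, mem_singleton_iff, mem_empty_iff_false, iff_false]
      rintro ⟨rfl, h⟩
      exact hT h
    rw [insert_eq, hμ _ _ (inC_of_empty_notMem hN hT') (inC_of_empty_notMem hN hs) hd, ih hs]
    have : ∀ S : Finset (Fin N), (({T} : FreeBoolAlg N) ∪ s).indicator (fun T => μ {T}) S =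
        (if S = T then μ {S} else 0) + s.indicator (fun T => μ {T}) S := by
      intro S
      by_cases h : S = T
      · subst h; simp [hT]
      · by_cases h' : S ∈ s <;> simp [h, h']
    simp_rw [this, Finset.sum_add_distrib]
    simp

theorem sum_indicator_union (w : Finset (Fin N) → ℝ) (f g : FreeBoolAlg N) :
    (∑ T, (f ∪ g).indicator w T) =
      (∑ T, f.indicator w T) + (∑ T, g.indicator w T) - ∑ T, (f ∩ g).indicator w T := by
  rw [← Finset.sum_add_distrib, ← Finset.sum_sub_distrib]
  refine Finset.sum_congr rfl fun T _ => ?_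
  by_cases h1 : T ∈ f <;> by_cases h2 : T ∈ g <;> simp [h1, h2]

theorem existsUnique_zeroWeightExt (hN : 1 ≤ N) {μ : FreeBoolAlg N → ℝ} (hμ : AdditiveOnC μ) :
    ∃! ν, IsZeroWeightExt μ ν := by
  let c : ℝ := ∑ T ∈ Finset.univ.erase (∅ : Finset (Fin N)), μ {T}
  let w : Finset (Fin N) → ℝ := fun T => if T = ∅ then -c else μ {T}
  have hex : IsZeroWeightExt μ (fun f => ∑ T, f.indicator w T) := by
    refine ⟨?_, ?_, ?_⟩
    · intro f hf
      have hf' := empty_notMem_of_inC hf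
      rw [additive_eq_sum hN hμ hf']
      refine Finset.sum_congr rfl fun T _ => ?_
      by_cases hT : T ∈ f
      · have : T ≠ ∅ := by rintro rfl; exact hf' hT
        simp [hT, w, this]
      · simp [hT]
    · exact fun f g => sum_indicator_union w f g
    · have : ∑ T ∈ Finset.univ.erase (∅ : Finset (Fin N)), w T = c := by
        refine Finset.sum_congr rfl fun T hT => ?_
        simp [w, Finset.ne_of_mem_erase hT]
      simp only [indicator_univ]
      rw [← Finset.add_sum_erase _ _ (Finset.mem_univ (∅ : Finset (Fin N))), this]
      simp [w]
  refine ⟨_, hex, ?_⟩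
  intro ν₁ h₁
  generalize (fun f : FreeBoolAlg N => ∑ T, f.indicator w T) = ν₂ at hex
  funext f
  by_cases hf : (∅ : Finset (Fin N)) ∈ f
  · have hc : InC fᶜ := inC_of_empty_notMem hN (by simpa using hf)
    have e₁ := h₁.2.1 f fᶜ
    have e₂ := hex.2.1 f fᶜ
    rw [union_compl_self, inter_compl_self, h₁.2.2, h₁.1 _ hc, h₁.1 _ (inC_empty hN)] at e₁
    rw [union_compl_self, inter_compl_self, hex.2.2, hex.1 _ hc, hex.1 _ (inC_empty hN)] at e₂
    linarith
  · have hc := inC_of_empty_notMem hN hf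
    rw [h₁.1 _ hc, hex.1 _ hc]

theorem moebius_aux {S T : Finset (Fin N)} (hS : S.Nonempty) :
    (∑ K : Finset (Fin N), if ¬ Disjoint K T ∧ Sᶜ ⊆ K then (-1 : ℤ) ^ ((K ∩ S).card + 1) else 0) =
      if S = T then 1 else 0 := by
  have h1 : (∑ K : Finset (Fin N),
      if ¬ Disjoint K T ∧ Sᶜ ⊆ K then (-1 : ℤ) ^ ((K ∩ S).card + 1) else 0) =
      ∑ J ∈ S.powerset, if ¬ Disjoint (Sᶜ ∪ J) T then (-1 : ℤ) ^ (J.card + 1) else 0 := by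
    have : (∑ K : Finset (Fin N),
        if ¬ Disjoint K T ∧ Sᶜ ⊆ K then (-1 : ℤ) ^ ((K ∩ S).card + 1) else 0) =
        ∑ K ∈ Finset.univ.filter (fun K : Finset (Fin N) => Sᶜ ⊆ K),
          if ¬ Disjoint K T then (-1 : ℤ) ^ ((K ∩ S).card + 1) else 0 := by
      rw [Finset.sum_filter]
      refine Finset.sum_congr rfl fun K _ => ?_
      by_cases h1 : Disjoint K T <;> by_cases h2 : Sᶜ ⊆ K <;> simp [h1, h2]
    rw [this]
    refine Finset.sum_bij' (fun K _ => K ∩ S) (fun J _ => Sᶜ ∪ J) ?_ ?_ ?_ ?_ ?_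
    · intro K _; simp
    · intro J _; simp
    · intro K hK
      simp only [Finset.mem_filter, Finset.mem_univ, true_and] at hK
      ext i
      have := @hK i
      simp only [Finset.mem_compl, Finset.mem_union, Finset.mem_inter] at *
      tauto
    · intro J hJ
      rw [Finset.mem_powerset] at hJ
      ext i
      have := @hJ i
      simp only [Finset.mem_compl, Finset.mem_union, Finset.mem_inter] at *
      tauto
    · intro K hK
      simp only [Finset.mem_filter, Finset.mem_univ, true_and] at hK
      have : Sᶜ ∪ K ∩ S = K := by
        ext i
        have := @hK i
        simp only [Finset.mem_compl, Finset.mem_union, Finset.mem_inter] at *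
        tauto
      simp only [this]
  have h2 : ∀ J ∈ S.powerset, (if ¬ Disjoint (Sᶜ ∪ J) T then (-1 : ℤ) ^ (J.card + 1) else 0) =
      (if Disjoint (Sᶜ ∪ J) T then (-1 : ℤ) ^ J.card else 0) - (-1 : ℤ) ^ J.card := by
    intro J _
    by_cases h : Disjoint (Sᶜ ∪ J) T <;> simp only [h, not_true, not_false_iff, if_true, if_false] <;>
      ring
  rw [h1, Finset.sum_congr rfl h2, Finset.sum_sub_distrib,
    Finset.sum_powerset_neg_one_pow_card_of_nonempty hS, sub_zero, ← Finset.sum_filter]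
  by_cases hTS : T ⊆ S
  · have : S.powerset.filter (fun J => Disjoint (Sᶜ ∪ J) T) = (S \ T).powerset := by
      ext J
      simp only [Finset.mem_filter, Finset.mem_powerset, Finset.disjoint_union_left,
        Finset.subset_sdiff]
      have : Disjoint Sᶜ T := disjoint_compl_left.mono_right hTS
      tauto
    rw [this, Finset.sum_powerset_neg_one_pow_card]
    by_cases h : S = T
    · simp [h]
    · have : ¬ S ⊆ T := fun h' => h (h'.antisymm hTS)
      simp [h, this]
  · have : S.powerset.filter (fun J => Disjoint (Sᶜ ∪ J) T) = ∅ := by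
      refine Finset.filter_eq_empty_iff.2 fun J _ h => hTS fun i hi => ?_
      by_contra hiS
      exact Finset.disjoint_left.1 (Finset.disjoint_union_left.1 h).1 (Finset.mem_compl.2 hiS) hi
    have hne : S ≠ T := by rintro rfl; exact hTS subset_rfl
    rw [this, if_neg hne, Finset.sum_empty]

theorem sum_nonemptySub {M : Type*} [AddCommMonoid M] (T : Finset (Fin N))
    (c : Finset (Fin N) → M) :
    (∑ K : NonemptySub N, if Disjoint K.1 T then 0 else c K.1) =
      ∑ K : Finset (Fin N), if Disjoint K T then 0 else c K := by
  have h := Finset.sum_subtype (F := inferInstanceAs (Fintype (NonemptySub N)))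
    (Finset.univ.filter fun K : Finset (Fin N) => K.Nonempty)
    (p := fun K => K.Nonempty) (by simp) (fun K => if Disjoint K T then 0 else c K)
  rw [← h, Finset.sum_filter]
  refine Finset.sum_congr rfl fun K _ => ?_
  by_cases hK : K.Nonempty
  · simp [hK]
  · simp [Finset.not_nonempty_iff_eq_empty.1 hK]

theorem additiveOnC_dirac (T : Finset (Fin N)) :
    AdditiveOnC (fun g : FreeBoolAlg N => g.indicator (fun _ => (1 : ℝ)) T) := by
  intro f g _ _ hfg
  by_cases h1 : T ∈ f <;> by_cases h2 : T ∈ g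
  · have : T ∈ f ∩ g := ⟨h1, h2⟩
    simp [hfg] at this
  all_goals simp [h1, h2]

theorem existsUnique_unionCoeff (hN : 1 ≤ N) {f : FreeBoolAlg N} (hf : InC f) :
    ∃! m, IsUnionCoeff f m := by
  classical
  have hf' := empty_notMem_of_inC hf
  refine existsUnique_of_exists_of_unique ?_ ?_
  · let M : Finset (Fin N) → ℤ := fun K =>
      ∑ S : Finset (Fin N), if S ∈ f ∧ Sᶜ ⊆ K then (-1 : ℤ) ^ ((K ∩ S).card + 1) else 0
    have hM : ∀ T, (∑ K : Finset (Fin N), if Disjoint K T then 0 else M K) =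
        if T ∈ f then 1 else 0 := by
      intro T
      have h1 : ∀ K : Finset (Fin N), (if Disjoint K T then 0 else M K) =
          ∑ S : Finset (Fin N), if S ∈ f then
            (if ¬ Disjoint K T ∧ Sᶜ ⊆ K then (-1 : ℤ) ^ ((K ∩ S).card + 1) else 0) else 0 := by
        intro K
        by_cases h : Disjoint K T
        · simp [h]
        · simp only [h, if_false, not_false_iff, true_and, M]
          refine Finset.sum_congr rfl fun S _ => ?_
          by_cases hS : S ∈ f <;> simp [hS]
      rw [Finset.sum_congr rfl fun K _ => h1 K, Finset.sum_comm]
      have h2 : ∀ S : Finset (Fin N), (∑ K : Finset (Fin N), if S ∈ f then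
            (if ¬ Disjoint K T ∧ Sᶜ ⊆ K then (-1 : ℤ) ^ ((K ∩ S).card + 1) else 0) else 0) =
          if S = T then (if T ∈ f then 1 else 0) else 0 := by
        intro S
        by_cases hS : S ∈ f
        · have hne : S.Nonempty := by
            rw [Finset.nonempty_iff_ne_empty]; rintro rfl; exact hf' hS
          simp only [hS, if_true]
          rw [moebius_aux hne]
          by_cases h : S = T
          · subst h; simp [hS]
          · simp [h]
        · by_cases h : S = T
          · subst h; simp [hS]
          · simp [hS, h]
      rw [Finset.sum_congr rfl fun S _ => h2 S]
      simp
    refine ⟨fun K => M K.1, fun μ hμ => ?_⟩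
    have hu : ∀ K : NonemptySub N, μ (unionVar K.1) =
        ∑ T : Finset (Fin N), if Disjoint K.1 T then 0 else μ {T} := by
      intro K
      rw [additive_eq_sum hN hμ (by simp [mem_unionVar])]
      refine Finset.sum_congr rfl fun T _ => ?_
      by_cases h : Disjoint K.1 T <;> simp [indicator, mem_unionVar, h]
    simp_rw [hu, Finset.mul_sum]
    rw [Finset.sum_comm, additive_eq_sum hN hμ hf']
    refine Finset.sum_congr rfl fun T _ => ?_
    have h3 : ∀ K : NonemptySub N, ((M K.1 : ℤ) : ℝ) * (if Disjoint K.1 T then 0 else μ {T}) =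
        ((if Disjoint K.1 T then 0 else M K.1 : ℤ) : ℝ) * μ {T} := by
      intro K
      by_cases h : Disjoint K.1 T <;> simp [h]
    rw [Finset.sum_congr rfl fun K _ => h3 K, ← Finset.sum_mul, ← Int.cast_sum,
      sum_nonemptySub T M, hM T]
    by_cases h : T ∈ f <;> simp [h]
  · intro m m' hm hm'
    have h0 : ∀ T : Finset (Fin N), T.Nonempty →
        ∑ K : NonemptySub N, (if Disjoint K.1 T then 0 else m K - m' K) = 0 := by
      intro T hT
      have e := (hm _ (additiveOnC_dirac T)).symm.trans (hm' _ (additiveOnC_dirac T))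
      have e' : ((∑ K : NonemptySub N, (if Disjoint K.1 T then 0 else m K - m' K) : ℤ) : ℝ) = 0 := by
        rw [← sub_eq_zero, ← Finset.sum_sub_distrib] at e
        rw [← e, Int.cast_sum]
        refine Finset.sum_congr rfl fun K _ => ?_
        by_cases h : Disjoint K.1 T <;> simp [indicator, mem_unionVar, h]
      exact_mod_cast e'
    have hall : ∑ K : NonemptySub N, (m K - m' K) = 0 := by
      have hne : (Finset.univ : Finset (Fin N)).Nonempty := ⟨⟨0, hN⟩, Finset.mem_univ _⟩
      rw [← h0 _ hne]
      refine Finset.sum_congr rfl fun K _ => ?_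
      have : ¬ Disjoint K.1 Finset.univ := by
        intro h
        obtain ⟨i, hi⟩ := K.2
        exact Finset.disjoint_left.1 h hi (Finset.mem_univ i)
      simp [this]
    have hsub : ∀ A : Finset (Fin N),
        ∑ K : NonemptySub N, (if K.1 ⊆ A then m K - m' K else 0) = 0 := by
      intro A
      by_cases hA : Aᶜ.Nonempty
      · have e : ∑ K : NonemptySub N, (if K.1 ⊆ A then m K - m' K else 0) =
            ∑ K : NonemptySub N, (m K - m' K) -
              ∑ K : NonemptySub N, (if Disjoint K.1 Aᶜ then 0 else m K - m' K) := by
          rw [← Finset.sum_sub_distrib]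
          refine Finset.sum_congr rfl fun K _ => ?_
          by_cases h : K.1 ⊆ A <;> simp [h, disjoint_compl_right_iff]
        rw [e, hall, h0 _ hA, sub_zero]
      · have : A = Finset.univ := by
          simpa [Finset.not_nonempty_iff_eq_empty] using hA
        subst this
        simpa using hall
    have hind : ∀ n : ℕ, ∀ K : NonemptySub N, K.1.card = n → m K - m' K = 0 := by
      intro n
      induction n using Nat.strong_induction_on with
      | _ n ih =>
        intro K hK
        have := hsub K.1
        rw [Finset.sum_eq_single K] at this
        · simpa using this
        · intro L _ hLK
          by_cases h : L.1 ⊆ K.1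
          · have hlt : L.1.card < n := hK ▸ Finset.card_lt_card
              (h.ssubset_of_ne fun h' => hLK (Subtype.ext h'))
            simp [ih _ hlt L rfl]
          · simp [h]
        · simp
    exact funext fun K => sub_eq_zero.1 (hind _ K rfl)

end FreeBoolAlg

/-! ## Quermassintegrals and intrinsic volumes -/

/-- `ℝ^d` with its Euclidean structure. -/
abbrev EucSpace (d : ℕ) : Type := EuclideanSpace ℝ (Fin d)

/-- The volume `κ_d` of the unit ball of `ℝ^d`. -/
noncomputable def unitBallVol (d : ℕ) : ℝ := volume.real (Metric.closedBall (0 : EucSpace d) 1)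

/-- `W` is the sequence of normalized coefficients in Steiner's formula
`Vol_d(K + B(0, r)) = ∑_{k=0}^d (d choose k) W_k r^k`, with the convention `W_k = 0` for `k > d`. -/
def IsQuermassSeq {d : ℕ} (K : Set (EucSpace d)) (W : ℕ → ℝ) : Prop :=
  (∀ r : ℝ, 0 ≤ r → volume.real (K + Metric.closedBall (0 : EucSpace d) r) =
    ∑ k ∈ Finset.range (d + 1), (d.choose k : ℝ) * W k * r ^ k) ∧ ∀ k, d < k → W k = 0

/-- `V` is the sequence of normalized coefficients in Steiner's formula
`Vol_d(K + B(0, r)) = ∑_{k=0}^d κ_{d-k} V_k r^{d-k}`, with the convention `V_k = 0` for `k > d`. -/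
def IsIntrinsicSeq {d : ℕ} (K : Set (EucSpace d)) (V : ℕ → ℝ) : Prop :=
  (∀ r : ℝ, 0 ≤ r → volume.real (K + Metric.closedBall (0 : EucSpace d) r) =
    ∑ k ∈ Finset.range (d + 1), unitBallVol (d - k) * V k * r ^ (d - k)) ∧ ∀ k, d < k → V k = 0

/-- The quermassintegrals `W_k^d(K)` of a non-empty compact convex set `K ⊆ ℝ^d`: the sequence with
`IsQuermassSeq K`, which exists by Steiner's formula. -/
noncomputable def quermass {d : ℕ} (K : Set (EucSpace d)) : ℕ → ℝ :=
  Classical.epsilon (IsQuermassSeq K)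

/-- The intrinsic volumes `V_k(K)` of a non-empty compact convex set `K ⊆ ℝ^d`: the sequence with
`IsIntrinsicSeq K`, which exists by Steiner's formula. -/
noncomputable def intrinsicVol {d : ℕ} (K : Set (EucSpace d)) : ℕ → ℝ :=
  Classical.epsilon (IsIntrinsicSeq K)

/-- The convex hull `K_I(p)` of the points `p_i`, `i ∈ I`. -/
def hullOf {N d : ℕ} (p : Fin N → EucSpace d) (I : Finset (Fin N)) : Set (EucSpace d) :=
  convexHull ℝ (p '' I)

/-- The Boolean quermassintegral `W_{f,k}^d(p)`: the `0`-weight extension to all `f` of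
`C_N ∋ f ↦ ∑_{∅ ≠ I ⊆ [N]} m_{f,I} W_k^d(K_I(p))`. -/
noncomputable def boolQuermass {N d : ℕ} (f : FreeBoolAlg N) (k : ℕ) (p : Fin N → EucSpace d) : ℝ :=
  FreeBoolAlg.zeroWeightExt
    (fun g => ∑ I : FreeBoolAlg.NonemptySub N, (g.unionCoeff I : ℝ) * quermass (hullOf p I.1) k) f

/-- The Boolean intrinsic volume `V_{f,k}(p)`: the `0`-weight extension to all `f` of
`C_N ∋ f ↦ ∑_{∅ ≠ I ⊆ [N]} m_{f,I} V_k(K_I(p))`. -/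
noncomputable def boolIntrinsicVol {N d : ℕ} (f : FreeBoolAlg N) (k : ℕ)
    (p : Fin N → EucSpace d) : ℝ :=
  FreeBoolAlg.zeroWeightExt
    (fun g => ∑ I : FreeBoolAlg.NonemptySub N, (g.unionCoeff I : ℝ) * intrinsicVol (hullOf p I.1) k) f

/-! The extension of a linear combination of data `b I` from `C_N` to the whole algebra is again a
linear combination, with coefficients `extCoeff f I` that depend on `f` alone
(`FreeBoolAlg.zeroWeightExt_sum`). Additivity and the rule for complements hold for any such
combination and involve no geometry. The other claims reduce to facts about the intrinsic volumes of
a single convex hull `hullOf p I` with `I` non-empty.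

Those facts come from a proof of Steiner's formula for polytopes. Sort each point of the parallel
body by its nearest point `y` and normal vector `z`: the vertices at which `⟪z, ·⟫` is maximal form
a face whose convex hull contains `y`. The resulting cells are disjoint. Each is an orthogonal
product of a polytope and a truncated cone, so its volume is a constant times `r ^ m`, where `m` is
the dimension of the normal space (`Steiner.volume_cell`, `Steiner.exists_hasSteinerCoeff`).

If the coefficients are taken relative to the volumes of balls, slicing orthogonally to a subspace
shows that they do not see the ambient dimension (`Steiner.HasSteinerCoeff.image`). Comparison with
large balls gives `V_0 = 1`. Continuity follows since the coefficients are fixed linear combinations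
of parallel volumes at positive radii, and these volumes are continuous in `p`. The relations
between `W` and `V` compare coefficients of one polynomial. The value of `V_{f,0}` comes from
testing the defining identity of `unionCoeff` on the point mass at the all-true assignment, which
lies in every `u_I`. -/

open Metric Module
open scoped RealInnerProductSpace ENNReal NNReal

/-! ## Steiner's formula for polytopes -/

namespace Steiner

variable {V : Type*} [NormedAddCommGroup V] [InnerProductSpace ℝ V]

open Classical in
/-- The vertices in `s` that maximize the linear functional `⟪z, ·⟫`. -/
noncomputable def face (s : Finset V) (z : V) : Finset V :=
  s.filter fun v => ∀ w ∈ s, ⟪z, w⟫ ≤ ⟪z, v⟫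

theorem mem_face {s : Finset V} {z v : V} : v ∈ face s z ↔ v ∈ s ∧ ∀ w ∈ s, ⟪z, w⟫ ≤ ⟪z, v⟫ := by
  simp [face]

theorem face_subset (s : Finset V) (z : V) : face s z ⊆ s := fun _ h => (mem_face.1 h).1

theorem inner_le_of_mem_convexHull {s : Set V} {z w : V} {t : ℝ} (h : ∀ v ∈ s, ⟪z, v⟫ ≤ t)
    (hw : w ∈ convexHull ℝ s) : ⟪z, w⟫ ≤ t :=
  convexHull_min (t := {v | ⟪z, v⟫ ≤ t}) h
    (convex_halfSpace_le (innerSL ℝ z).toLinearMap.isLinear t) hw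

theorem inner_le_of_mem_convexHull_face {s : Finset V} {z y w : V}
    (hy : y ∈ convexHull ℝ (face s z : Set V)) (hw : w ∈ convexHull ℝ (s : Set V)) :
    ⟪z, w⟫ ≤ ⟪z, y⟫ := by
  refine inner_le_of_mem_convexHull (fun v hv => ?_) hw
  exact convexHull_min (t := {y | ⟪z, v⟫ ≤ ⟪z, y⟫}) (fun u hu => (mem_face.1 hu).2 v hv)
    (convex_halfSpace_ge (innerSL ℝ z).toLinearMap.isLinear _) hy

theorem mem_convexHull_face {s : Finset V} {z y : V} (hy : y ∈ convexHull ℝ (s : Set V))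
    (h : ∀ w ∈ s, ⟪z, w⟫ ≤ ⟪z, y⟫) : y ∈ convexHull ℝ (face s z : Set V) := by
  obtain ⟨c, hc0, hc1, hcy⟩ := Finset.mem_convexHull'.1 hy
  -- The terms are non-negative with sum zero, so a vertex of positive weight attains the maximum
  -- `⟪z, y⟫`.
  have hsum : ∑ v ∈ s, c v * (⟪z, y⟫ - ⟪z, v⟫) = 0 := by
    simp_rw [mul_sub, Finset.sum_sub_distrib, ← Finset.sum_mul, hc1]
    nth_rewrite 1 [← hcy]
    simp [inner_sum, inner_smul_right]
  have hz := (Finset.sum_eq_zero_iff_of_nonneg fun v hv =>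
    mul_nonneg (hc0 v hv) (sub_nonneg.2 (h v hv))).1 hsum
  have hne : ∀ v ∈ s, v ∉ face s z → c v = 0 := by
    intro v hv hvf
    rcases mul_eq_zero.1 (hz v hv) with h0 | h0
    · exact h0
    · refine absurd (mem_face.2 ⟨hv, fun w hw => ?_⟩) hvf
      linarith [h w hw]
  refine Finset.mem_convexHull'.2 ⟨c, fun v hv => hc0 v (face_subset s z hv), ?_, ?_⟩
  · rw [← hc1]
    exact Finset.sum_subset (face_subset s z) hne
  · rw [← hcy]
    exact Finset.sum_subset (face_subset s z) fun v hv hvf => by rw [hne v hv hvf, zero_smul]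

/-- Take `z = x - y` with `y` the point of the polytope nearest to `x`. The variational inequality
for `y` says that `⟪z, ·⟫` is maximal at `y`. -/
theorem exists_face_decomposition {s : Finset V} (hs : s.Nonempty) (x : V) :
    ∃ z, x - z ∈ convexHull ℝ (face s z : Set V) := by
  have hcomp : IsCompact (convexHull ℝ (s : Set V)) := s.finite_toSet.isCompact_convexHull ℝ
  obtain ⟨y, hy, h⟩ := exists_norm_eq_iInf_of_complete_convex
    (convexHull_nonempty_iff.2 (Finset.coe_nonempty.2 hs)) hcomp.isComplete (convex_convexHull ℝ _) x
  rw [norm_eq_iInf_iff_real_inner_le_zero (convex_convexHull ℝ _) hy] at h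
  refine ⟨x - y, ?_⟩
  rw [sub_sub_cancel]
  refine mem_convexHull_face hy fun w hw => ?_
  have := h w (subset_convexHull ℝ _ hw)
  rw [inner_sub_right] at this
  linarith

theorem face_decomposition_unique {s : Finset V} {x z z' : V}
    (h : x - z ∈ convexHull ℝ (face s z : Set V)) (h' : x - z' ∈ convexHull ℝ (face s z' : Set V)) :
    z = z' := by
  have hmono := fun z => convexHull_mono (𝕜 := ℝ) (Finset.coe_subset.2 (face_subset s z))
  have h1 := inner_le_of_mem_convexHull_face h (hmono _ h')
  have h2 := inner_le_of_mem_convexHull_face h' (hmono _ h)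
  -- Each normal vector is maximal at its own foot point; adding the two inequalities cancels `x`.
  have h3 : ⟪z - z', z - z'⟫ ≤ 0 := by
    simp only [inner_sub_left, inner_sub_right] at *
    linarith
  rw [real_inner_self_eq_norm_sq] at h3
  exact sub_eq_zero.1 (norm_eq_zero.1 (pow_eq_zero_iff two_ne_zero |>.1 (h3.antisymm (sq_nonneg _))))

theorem mem_cthickening_iff {E : Type*} [SeminormedAddCommGroup E] {K : Set E} (hK : IsCompact K)
    {r : ℝ} (hr : 0 ≤ r) {x : E} :
    x ∈ cthickening r K ↔ ∃ y ∈ K, ‖x - y‖ ≤ r := by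
  simp [hK.cthickening_eq_biUnion_closedBall hr, dist_eq_norm]

/-- The foot point `x - z` is the nearest point of the polytope: for any other `y` in it, the cross
term in `‖z + (x - z - y)‖ ^ 2` is non-negative. -/
theorem mem_cthickening_iff_norm_le {s : Finset V} {x z : V}
    (h : x - z ∈ convexHull ℝ (face s z : Set V)) {r : ℝ} (hr : 0 ≤ r) :
    x ∈ cthickening r (convexHull ℝ (s : Set V)) ↔ ‖z‖ ≤ r := by
  rw [mem_cthickening_iff (s.finite_toSet.isCompact_convexHull ℝ) hr]
  constructor
  · rintro ⟨y, hy, hyr⟩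
    refine le_trans ?_ hyr
    have h1 := inner_le_of_mem_convexHull_face h hy
    have h2 : x - y = z + (x - z - y) := by abel
    have h3 := norm_add_sq_real z (x - z - y)
    rw [inner_sub_right] at h3
    rw [h2]
    refine le_of_sq_le_sq ?_ (norm_nonneg _)
    nlinarith [sq_nonneg ‖x - z - y‖]
  · intro hz
    refine ⟨x - z, convexHull_mono (Finset.coe_subset.2 (face_subset s z)) h, ?_⟩
    rwa [sub_sub_cancel]

/-- The points within distance `r` of the polytope whose normal vector exposes the face `F`. -/
def cell (s F : Finset V) (r : ℝ) : Set V :=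
  {x | ∃ z, x - z ∈ convexHull ℝ (F : Set V) ∧ face s z = F ∧ ‖z‖ ≤ r}

theorem cthickening_eq_biUnion_cell {s : Finset V} (hs : s.Nonempty) {r : ℝ} (hr : 0 ≤ r) :
    cthickening r (convexHull ℝ (s : Set V)) = ⋃ F ∈ s.powerset, cell s F r := by
  ext x
  simp only [mem_iUnion, exists_prop, Finset.mem_powerset]
  constructor
  · intro hx
    obtain ⟨z, hz⟩ := exists_face_decomposition hs x
    exact ⟨face s z, face_subset s z, z, hz, rfl, (mem_cthickening_iff_norm_le hz hr).1 hx⟩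
  · rintro ⟨F, -, z, hz, rfl, hzr⟩
    exact (mem_cthickening_iff_norm_le hz hr).2 hzr

theorem pairwiseDisjoint_cell (s : Finset V) (r : ℝ) (S : Set (Finset V)) :
    S.PairwiseDisjoint fun F => cell s F r := by
  intro F _ G _ hFG
  refine Set.disjoint_left.2 ?_
  rintro x ⟨z, hz, rfl, -⟩ ⟨z', hz', rfl, -⟩
  exact hFG (by rw [face_decomposition_unique hz hz'])

theorem face_smul (s : Finset V) {r : ℝ} (hr : 0 < r) (z : V) : face s (r • z) = face s z := by
  ext v
  simp only [mem_face, real_inner_smul_left, mul_le_mul_iff_right₀ hr]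

theorem cell_empty (s : Finset V) (r : ℝ) : cell s ∅ r = ∅ := by
  ext x; simp [cell]

theorem mem_orthogonal_vectorSpan_face {s : Finset V} {z : V} :
    z ∈ (vectorSpan ℝ (face s z : Set V))ᗮ := by
  rw [Submodule.mem_orthogonal]
  suffices h : vectorSpan ℝ (face s z : Set V) ≤ LinearMap.ker (innerSL ℝ z).toLinearMap by
    intro u hu
    rw [real_inner_comm]
    exact h hu
  refine Submodule.span_le.2 ?_
  rintro _ ⟨v, hv, w, hw, rfl⟩
  have h1 := (mem_face.1 hv).2 w (mem_face.1 hw).1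
  have h2 := (mem_face.1 hw).2 v (mem_face.1 hv).1
  have : ⟪z, v - w⟫ = 0 := by rw [inner_sub_right]; linarith
  simpa using this

/-! ### Measurability and volume of the cells -/

variable [MeasurableSpace V] [BorelSpace V]

theorem measurableSet_face_eq {s F : Finset V} (W : Submodule ℝ V) :
    MeasurableSet {z : W | face s (z : V) = F} := by
  classical
  -- Vertices outside `s ∪ F` belong to neither side, so finitely many conditions suffice, each a
  -- Boolean combination of closed half-spaces.
  have h : {z : W | face s (z : V) = F} =
      ⋂ v ∈ s ∪ F, {z : W | (v ∈ s ∧ ∀ w ∈ s, ⟪(z : V), w⟫ ≤ ⟪(z : V), v⟫) ↔ v ∈ F} := by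
    ext z
    simp only [Finset.ext_iff, mem_face, mem_ofPred_eq, mem_iInter, Finset.mem_union]
    constructor
    · exact fun h v _ => h v
    · intro h v
      by_cases hv : v ∈ s ∨ v ∈ F
      · exact h v hv
      · tauto
  rw [h]
  refine Finset.measurableSet_biInter _ fun v _ => ?_
  have hm : MeasurableSet {z : W | v ∈ s ∧ ∀ w ∈ s, ⟪(z : V), w⟫ ≤ ⟪(z : V), v⟫} := by
    have : {z : W | v ∈ s ∧ ∀ w ∈ s, ⟪(z : V), w⟫ ≤ ⟪(z : V), v⟫} =
        {_z : W | v ∈ s} ∩ ⋂ w ∈ s, {z : W | ⟪(z : V), w⟫ ≤ ⟪(z : V), v⟫} := by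
      ext z; simp
    rw [this]
    refine (MeasurableSet.const _).inter (Finset.measurableSet_biInter _ fun w _ => ?_)
    exact (isClosed_le (by fun_prop) (by fun_prop)).measurableSet
  by_cases hF : v ∈ F
  · simpa only [hF, iff_true] using hm
  · simp only [hF, iff_false]
    exact hm.compl

variable [FiniteDimensional ℝ V]

section Product

variable {U : Type*} [NormedAddCommGroup U] [InnerProductSpace ℝ U] [FiniteDimensional ℝ U]
  [MeasurableSpace U] [BorelSpace U]

/-- Orthogonal coordinates adapted to an affine isometry `x ↦ c + L x`. -/
theorem exists_measurePreserving_prod (L : U →ₗᵢ[ℝ] V) (W : Submodule ℝ V)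
    (hW : W = (LinearMap.range L.toLinearMap)ᗮ) (c : V) :
    ∃ e : W × U ≃ᵐ V, MeasurePreserving e (volume.prod volume) volume ∧
      ∀ q, e q = c + (q.1 + L q.2) := by
  have hperp : ∀ (w : W) (u : U), ⟪(w : V), L u⟫ = 0 := by
    intro w u
    have : (w : V) ∈ (LinearMap.range L.toLinearMap)ᗮ := hW ▸ w.2
    exact (Submodule.mem_orthogonal' _ _).1 this _ ⟨u, rfl⟩
  let M₀ : WithLp 2 (W × U) →ₗ[ℝ] V :=
    (W.subtype.coprod L.toLinearMap) ∘ₗ (WithLp.linearEquiv 2 ℝ (W × U)).toLinearMap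
  have hM₀ : ∀ q, M₀ q = q.fst + L q.snd := fun q => rfl
  -- With the `L²` norm on the product, orthogonality of `W` and the range of `L` is Pythagoras'
  -- theorem. The dimension count `hdim` then makes `M` surjective.
  let M : WithLp 2 (W × U) →ₗᵢ[ℝ] V := ⟨M₀, fun q => by
    rw [← sq_eq_sq₀ (norm_nonneg _) (norm_nonneg _), WithLp.prod_norm_sq_eq_of_L2, hM₀,
      norm_add_sq_real, hperp, L.norm_map]
    simp⟩
  have hdim : finrank ℝ (WithLp 2 (W × U)) = finrank ℝ V := by
    rw [(WithLp.linearEquiv 2 ℝ (W × U)).finrank_eq, finrank_prod,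
      ← LinearMap.finrank_range_of_inj L.injective, hW, add_comm]
    exact Submodule.finrank_add_finrank_orthogonal _
  let M' := M.toLinearIsometryEquiv hdim
  refine ⟨((MeasurableEquiv.toLp 2 (W × U)).trans M'.toMeasurableEquiv).trans
    (MeasurableEquiv.addLeft c), ?_, fun q => rfl⟩
  exact ((WithLp.volume_preserving_symm_measurableEquiv_toLp_prod W U).symm.trans
    M'.measurePreserving).trans (measurePreserving_add_left volume c)

end Product

/-- The normals exposing `F` are stable under positive scaling, so for `r > 0` this is the scaling
law of Haar measure. The case `r = 0` is separate, and there `0 ^ 0 = 1` is the right value when `W`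
is trivial. -/
theorem volume_normalCone (s F : Finset V) (W : Submodule ℝ V) {r : ℝ} (hr : 0 ≤ r) :
    volume {z : W | face s (z : V) = F ∧ ‖z‖ ≤ r} =
      ENNReal.ofReal (r ^ finrank ℝ W) * volume {z : W | face s (z : V) = F ∧ ‖z‖ ≤ 1} := by
  rcases hr.eq_or_lt with rfl | hr
  · rcases Nat.eq_zero_or_pos (finrank ℝ W) with h0 | h0
    · have : Subsingleton W := finrank_zero_iff.1 h0
      have h : ∀ z : W, ‖z‖ = 0 := fun z => by rw [Subsingleton.elim z 0, norm_zero]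
      simp [h0, h]
    · have : Nontrivial W := finrank_pos_iff.1 h0
      rw [zero_pow h0.ne', ENNReal.ofReal_zero, zero_mul]
      refine measure_mono_null (t := {0}) ?_ (measure_singleton 0)
      rintro z ⟨-, hz⟩
      simpa using hz
  · have : {z : W | face s (z : V) = F ∧ ‖z‖ ≤ r} =
        r • {z : W | face s (z : V) = F ∧ ‖z‖ ≤ 1} := by
      ext z
      rw [mem_smul_set_iff_inv_smul_mem₀ hr.ne']
      simp only [mem_ofPred_eq, Submodule.coe_smul, face_smul s (inv_pos.2 hr), norm_smul,
        Real.norm_of_nonneg (inv_nonneg.2 hr.le)]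
      rw [inv_mul_le_one₀ hr]
    rw [this, Measure.addHaar_smul, abs_of_nonneg (pow_nonneg hr.le _)]

/-- In coordinates along the direction space `E` of `F` and along `Eᗮ`, the cell is the product of
`conv F` and the truncated normal cone. Here `k = dim E`, and the cone factor is homogeneous of
degree `dim Eᗮ`, like the volume of a ball of that dimension. -/
theorem volume_cell (s F : Finset V) :
    ∃ (c : ℝ≥0) (k : ℕ), k ≤ finrank ℝ V ∧ ∀ r : ℝ, 0 ≤ r → MeasurableSet (cell s F r) ∧
      volume (cell s F r) = c * volume (closedBall (0 : EucSpace (finrank ℝ V - k)) r) := by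
  rcases F.eq_empty_or_nonempty with rfl | ⟨v₀, hv₀⟩
  · exact ⟨0, 0, Nat.zero_le _, fun r _ => by simp [cell_empty]⟩
  let E : Submodule ℝ V := vectorSpan ℝ (F : Set V)
  obtain ⟨e, he, heq⟩ := exists_measurePreserving_prod E.subtypeₗᵢ Eᗮ
    (by congr 1; exact E.range_subtype.symm) v₀
  let A : Set E := {a | v₀ + (a : V) ∈ convexHull ℝ (F : Set V)}
  let C : ℝ → Set Eᗮ := fun r => {z | face s (z : V) = F ∧ ‖z‖ ≤ r}
  have hK : IsCompact (convexHull ℝ (F : Set V)) := F.finite_toSet.isCompact_convexHull ℝ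
  have hA : MeasurableSet A := (hK.isClosed.preimage (by fun_prop)).measurableSet
  have hAf : volume A ≠ ∞ := by
    have hiso : Isometry fun a : E => v₀ + (a : V) :=
      (isometry_add_left v₀).comp E.subtypeₗᵢ.isometry
    exact (hiso.antilipschitz.isBounded_preimage hK.isBounded).measure_lt_top.ne
  have hC : ∀ r, MeasurableSet (C r) := fun r =>
    (measurableSet_face_eq _).inter (isClosed_le continuous_norm continuous_const).measurableSet
  have hCf : volume (C 1) ≠ ∞ := by
    refine ((isBounded_closedBall (x := (0 : Eᗮ)) (r := 1)).subset ?_).measure_lt_top.ne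
    intro z hz
    simpa using hz.2
  have hcell : ∀ r, cell s F r = e '' (C r ×ˢ A) := by
    intro r
    ext x
    constructor
    · rintro ⟨z, hz, hzF, hzr⟩
      have hzE : z ∈ Eᗮ := by
        have := mem_orthogonal_vectorSpan_face (s := s) (z := z)
        rwa [hzF] at this
      have hxE : x - z - v₀ ∈ E := by
        change x - z - v₀ ∈ vectorSpan ℝ (F : Set V)
        rw [← direction_affineSpan]
        exact AffineSubspace.vsub_mem_direction (convexHull_subset_affineSpan _ hz)
          (subset_affineSpan ℝ _ hv₀)
      refine ⟨(⟨z, hzE⟩, ⟨x - z - v₀, hxE⟩), ⟨⟨hzF, hzr⟩, ?_⟩, ?_⟩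
      · simpa [A] using hz
      · simp only [heq, Submodule.coe_subtypeₗᵢ, Submodule.subtype_apply]
        abel
    · rintro ⟨⟨z, a⟩, ⟨⟨hzF, hzr⟩, ha⟩, rfl⟩
      refine ⟨z, ?_, hzF, hzr⟩
      have : e (z, a) - z = v₀ + a := by
        simp only [heq, Submodule.coe_subtypeₗᵢ, Submodule.subtype_apply]
        abel
      rw [this]
      exact ha
  have hk : finrank ℝ V - finrank ℝ E = finrank ℝ Eᗮ := by
    have := E.finrank_add_finrank_orthogonal
    omega
  -- Dividing by the unit ball volume makes the constant a coefficient relative to balls.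
  let β : ℝ≥0∞ := volume (closedBall (0 : EucSpace (finrank ℝ Eᗮ)) 1)
  have hβ0 : β ≠ 0 := (measure_closedBall_pos volume _ one_pos).ne'
  have hβf : β ≠ ∞ := measure_closedBall_lt_top.ne
  refine ⟨(volume (C 1) * volume A / β).toNNReal, finrank ℝ E, E.finrank_le, fun r hr => ⟨?_, ?_⟩⟩
  · rw [hcell]
    exact e.measurableSet_image.2 ((hC r).prod hA)
  · rw [ENNReal.coe_toNNReal (ENNReal.div_ne_top (ENNReal.mul_ne_top hCf hAf) hβ0), hcell,
      ← e.preimage_symm, he.symm.measure_preimage ((hC r).prod hA).nullMeasurableSet,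
      Measure.prod_prod, volume_normalCone s F _ hr, Measure.addHaar_closedBall' _ _ hr,
      finrank_euclideanSpace_fin, hk, mul_left_comm (_ / β), ENNReal.div_mul_cancel hβ0 hβf,
      mul_assoc]

/-- Steiner's formula for the volume of the parallel sets of `K`. -/
def HasSteinerCoeff (K : Set V) (a : ℕ → ℝ≥0) : Prop :=
  (∀ r : ℝ, 0 ≤ r → volume (cthickening r K) = ∑ k ∈ Finset.range (finrank ℝ V + 1),
    (a k : ℝ≥0∞) * volume (closedBall (0 : EucSpace (finrank ℝ V - k)) r)) ∧
  ∀ k, finrank ℝ V < k → a k = 0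

/-- The coefficient of index `j` collects the constants of all cells whose index `k F` from
`volume_cell` is `j`. -/
theorem exists_hasSteinerCoeff {s : Finset V} (hs : s.Nonempty) :
    ∃ a, HasSteinerCoeff (convexHull ℝ (s : Set V)) a := by
  classical
  choose c k hk h using volume_cell s
  refine ⟨fun j => ∑ F ∈ s.powerset with k F = j, c F, fun r hr => ?_, fun j hj => ?_⟩
  · rw [cthickening_eq_biUnion_cell hs hr, measure_biUnion_finset (pairwiseDisjoint_cell s r _)
      fun F _ => (h F r hr).1, ← Finset.sum_fiberwise_of_maps_to (g := k)
      (t := Finset.range (finrank ℝ V + 1)) fun F _ => by simpa using Nat.lt_succ_of_le (hk F)]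
    refine Finset.sum_congr rfl fun j _ => ?_
    rw [ENNReal.ofNNReal_finsetSum, Finset.sum_mul]
    refine Finset.sum_congr rfl fun F hF => ?_
    rw [(h F r hr).2, (Finset.mem_filter.1 hF).2]
  · refine Finset.sum_eq_zero fun F hF => ?_
    have := hk F
    have := (Finset.mem_filter.1 hF).2
    omega

end Steiner

/-! ### Steiner coefficients: ambient dimension and normalization -/

namespace Steiner

section Dimension

variable {U V : Type*} [NormedAddCommGroup U] [InnerProductSpace ℝ U] [FiniteDimensional ℝ U]
  [MeasurableSpace U] [BorelSpace U] [NormedAddCommGroup V] [InnerProductSpace ℝ V]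
  [FiniteDimensional ℝ V] [MeasurableSpace V] [BorelSpace V]

theorem volume_closedBall_of_finrank_eq {m : ℕ} (h : finrank ℝ U = m) (r : ℝ) :
    volume (closedBall (0 : U) r) = volume (closedBall (0 : EucSpace m) r) := by
  subst h
  have hb := (stdOrthonormalBasis ℝ U).measurePreserving_repr
  rw [← hb.measure_preimage measurableSet_closedBall.nullMeasurableSet,
    LinearIsometryEquiv.preimage_closedBall, map_zero]

theorem volume_prod_ball {m : ℕ} (h : finrank ℝ U + finrank ℝ V = m) {r : ℝ} (hr : 0 ≤ r) :
    (volume.prod volume) {q : U × V | ‖q.1‖ ^ 2 + ‖q.2‖ ^ 2 ≤ r ^ 2} =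
      volume (closedBall (0 : EucSpace m) r) := by
  have hfin : finrank ℝ (WithLp 2 (U × V)) = m := by
    rw [(WithLp.linearEquiv 2 ℝ (U × V)).finrank_eq, finrank_prod, h]
  rw [← volume_closedBall_of_finrank_eq hfin, ← (WithLp.volume_preserving_toLp U V).measure_preimage
    measurableSet_closedBall.nullMeasurableSet]
  congr 1
  ext q
  rw [mem_preimage, mem_closedBall_zero_iff, ← sq_le_sq₀ (norm_nonneg _) hr,
    WithLp.prod_norm_sq_eq_of_L2]
  rfl

/-- Over `w` orthogonal to the image, the slice of the parallel body of radius `r` is the parallel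
body of `K` of radius `√(r² - ‖w‖²)`. Steiner's formula in `U` turns its volume into volumes of
balls of this radius, which are themselves slices of balls of radius `r` in larger dimension.
Integrating over `w` keeps every `a k`. -/
theorem HasSteinerCoeff.image {K : Set U} {a : ℕ → ℝ≥0} (h : HasSteinerCoeff K a)
    (hK : IsCompact K) (L : U →ₗᵢ[ℝ] V) (c : V) :
    HasSteinerCoeff ((fun u => c + L u) '' K) a := by
  have hL : finrank ℝ (LinearMap.range L.toLinearMap) = finrank ℝ U :=
    LinearMap.finrank_range_of_inj L.injective
  have hdim := (LinearMap.range L.toLinearMap).finrank_add_finrank_orthogonal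
  obtain ⟨e, he, heq⟩ := exists_measurePreserving_prod L _ rfl c
  generalize hW : (LinearMap.range L.toLinearMap)ᗮ = W at *
  rw [hL] at hdim
  refine ⟨fun r hr => ?_, fun k hk => h.2 k (by omega)⟩
  have hperp : ∀ (w : W) (u : U), ⟪(w : V), L u⟫ = 0 := by
    intro w u
    have : (w : V) ∈ (LinearMap.range L.toLinearMap)ᗮ := hW ▸ w.2
    exact (Submodule.mem_orthogonal' _ _).1 this _ ⟨u, rfl⟩
  have hK' : IsCompact ((fun u => c + L u) '' K) :=
    hK.image (continuous_const.add L.continuous)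
  have hm : MeasurableSet (cthickening r ((fun u => c + L u) '' K)) :=
    isClosed_cthickening.measurableSet
  let B : ∀ k, Set (W × EucSpace (finrank ℝ U - k)) := fun k => {q | ‖q.1‖ ^ 2 + ‖q.2‖ ^ 2 ≤ r ^ 2}
  have hB : ∀ k, MeasurableSet (B k) := fun k =>
    (isClosed_le (by fun_prop) continuous_const).measurableSet
  have hslice : ∀ w : W, volume (Prod.mk w ⁻¹' (e ⁻¹' cthickening r ((fun u => c + L u) '' K))) =
      ∑ k ∈ Finset.range (finrank ℝ U + 1), (a k : ℝ≥0∞) * volume (Prod.mk w ⁻¹' B k) := by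
    intro w
    have hmem : Prod.mk w ⁻¹' (e ⁻¹' cthickening r ((fun u => c + L u) '' K)) =
        {x | ∃ y ∈ K, ‖x - y‖ ^ 2 ≤ r ^ 2 - ‖w‖ ^ 2} := by
      ext x
      simp only [mem_preimage, mem_cthickening_iff hK' hr, exists_mem_image, heq, mem_ofPred_eq]
      refine exists_congr fun y => and_congr_right fun _ => ?_
      have : c + ((w : V) + L x) - (c + L y) = w + L (x - y) := by rw [map_sub]; abel
      rw [this, ← sq_le_sq₀ (norm_nonneg _) hr, norm_add_sq_real, hperp, L.norm_map,
        le_sub_iff_add_le', mul_zero, add_zero, Submodule.coe_norm]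
    rw [hmem]
    rcases le_or_gt 0 (r ^ 2 - ‖w‖ ^ 2) with ht | ht
    · have h1 : {x | ∃ y ∈ K, ‖x - y‖ ^ 2 ≤ r ^ 2 - ‖w‖ ^ 2} =
          cthickening √(r ^ 2 - ‖w‖ ^ 2) K := by
        ext x
        simp only [mem_cthickening_iff hK (Real.sqrt_nonneg _), mem_ofPred_eq,
          Real.le_sqrt (norm_nonneg _) ht]
      have h2 : ∀ k, Prod.mk w ⁻¹' B k = closedBall 0 √(r ^ 2 - ‖w‖ ^ 2) := by
        intro k
        ext x
        simp only [B, mem_preimage, mem_ofPred_eq, mem_closedBall_zero_iff,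
          Real.le_sqrt (norm_nonneg _) ht, le_sub_iff_add_le']
      simp_rw [h1, h2]
      exact h.1 _ (Real.sqrt_nonneg _)
    -- For `‖w‖ > r` the slices on both sides are empty.
    · have h1 : {x | ∃ y ∈ K, ‖x - y‖ ^ 2 ≤ r ^ 2 - ‖w‖ ^ 2} = ∅ := by
        refine eq_empty_of_forall_notMem ?_
        rintro x ⟨y, -, hy⟩
        exact absurd (hy.trans_lt ht) (sq_nonneg _).not_gt
      have h2 : ∀ k, Prod.mk w ⁻¹' B k = ∅ := by
        intro k
        refine eq_empty_of_forall_notMem fun x hx => ?_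
        simp only [B, mem_preimage, mem_ofPred_eq] at hx
        nlinarith [sq_nonneg ‖x‖]
      simp_rw [h1, h2]
      simp
  rw [← he.measure_preimage hm.nullMeasurableSet, Measure.prod_apply (e.measurable hm),
    lintegral_congr hslice, lintegral_finsetSum _ fun k _ =>
      (measurable_measure_prodMk_left (hB k)).const_mul _]
  have hsum : ∀ k ∈ Finset.range (finrank ℝ U + 1),
      ∫⁻ w, (a k : ℝ≥0∞) * volume (Prod.mk w ⁻¹' B k) =
        a k * volume (closedBall (0 : EucSpace (finrank ℝ V - k)) r) := by
    intro k hk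
    rw [lintegral_const_mul _ (measurable_measure_prodMk_left (hB k)), ← Measure.prod_apply (hB k)]
    congr 1
    refine volume_prod_ball ?_ hr
    rw [finrank_euclideanSpace_fin]
    have := Finset.mem_range.1 hk
    omega
  rw [Finset.sum_congr rfl hsum]
  -- The extra indices between `dim U` and `dim V` carry zero coefficients.
  refine Finset.sum_subset (Finset.range_mono (by omega)) fun k _ hk => ?_
  rw [Finset.mem_range] at hk
  rw [h.2 k (by omega), ENNReal.coe_zero, zero_mul]

theorem HasSteinerCoeff.volume_real {K : Set V} {a : ℕ → ℝ≥0} (h : HasSteinerCoeff K a) {r : ℝ}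
    (hr : 0 ≤ r) : volume.real (cthickening r K) = ∑ k ∈ Finset.range (finrank ℝ V + 1),
      unitBallVol (finrank ℝ V - k) * a k * r ^ (finrank ℝ V - k) := by
  rw [measureReal_def, h.1 r hr, ENNReal.toReal_sum
    fun k _ => ENNReal.mul_ne_top ENNReal.coe_ne_top measure_closedBall_lt_top.ne]
  refine Finset.sum_congr rfl fun k _ => ?_
  rw [ENNReal.toReal_mul, ← measureReal_def, Measure.addHaar_real_closedBall' _ _ hr,
    finrank_euclideanSpace_fin, ENNReal.coe_toReal, unitBallVol]
  ring

theorem unitBallVol_pos (d : ℕ) : 0 < unitBallVol d :=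
  ENNReal.toReal_pos (measure_closedBall_pos volume _ one_pos).ne' measure_closedBall_lt_top.ne

/-- For large radius the parallel body lies between balls of radii `r` and `r + R` about a point of
`K`, so its volume is asymptotic to `κ_n r ^ n`. -/
theorem HasSteinerCoeff.apply_zero {K : Set V} {a : ℕ → ℝ≥0} (h : HasSteinerCoeff K a)
    (hK : IsCompact K) (hne : K.Nonempty) : a 0 = 1 := by
  obtain ⟨p, hp⟩ := hne
  obtain ⟨R, hR⟩ := hK.isBounded.subset_closedBall p
  have hR0 : 0 ≤ R := nonneg_of_mem_closedBall (hR hp)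
  set n := finrank ℝ V with hn
  have hball : ∀ r : ℝ, 0 ≤ r → volume.real (closedBall p r) = r ^ n * unitBallVol n := by
    intro r hr
    rw [Measure.addHaar_real_closedBall' _ _ hr, unitBallVol, measureReal_def, measureReal_def,
      volume_closedBall_of_finrank_eq hn.symm]
  -- The Steiner polynomial reversed by `r = t⁻¹`: its value at `t = 0` is the leading coefficient,
  -- and continuity replaces a limit at infinity.
  let f : ℝ → ℝ := fun t => ∑ k ∈ Finset.range (n + 1), unitBallVol (n - k) * a k * t ^ k
  have hf : ∀ t : ℝ, 0 < t → t⁻¹ ^ n * f t = volume.real (cthickening t⁻¹ K) := by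
    intro t ht
    rw [h.volume_real (inv_nonneg.2 ht.le), Finset.mul_sum]
    refine Finset.sum_congr rfl fun k hk => ?_
    have hk' : k ≤ n := Nat.lt_succ_iff.1 (Finset.mem_range.1 hk)
    have hpow : t⁻¹ ^ n * t ^ k = t⁻¹ ^ (n - k) := by
      rw [← Nat.sub_add_cancel hk', pow_add, Nat.add_sub_cancel, mul_assoc, ← mul_pow,
        inv_mul_cancel₀ ht.ne', one_pow, mul_one]
    rw [mul_left_comm, hpow]
  have hfin : ∀ t, volume (cthickening t K) ≠ ∞ := fun t =>
    hK.isBounded.cthickening.measure_lt_top.ne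
  have hlow : ∀ t : ℝ, 0 < t → unitBallVol n ≤ f t := by
    intro t ht
    have h1 : volume.real (closedBall p t⁻¹) ≤ volume.real (cthickening t⁻¹ K) :=
      measureReal_mono (closedBall_subset_cthickening hp _) (hfin _)
    rw [hball _ (inv_nonneg.2 ht.le), ← hf t ht] at h1
    exact le_of_mul_le_mul_left h1 (by positivity)
  have hupp : ∀ t : ℝ, 0 < t → f t ≤ (1 + R * t) ^ n * unitBallVol n := by
    intro t ht
    have hsub : cthickening t⁻¹ K ⊆ closedBall p (t⁻¹ + R) := by
      intro x hx
      obtain ⟨y, hy, hxy⟩ := (mem_cthickening_iff hK (inv_nonneg.2 ht.le)).1 hx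
      rw [← dist_eq_norm] at hxy
      exact (dist_triangle x y p).trans (add_le_add hxy (hR hy))
    have h1 : volume.real (cthickening t⁻¹ K) ≤ volume.real (closedBall p (t⁻¹ + R)) :=
      measureReal_mono hsub measure_closedBall_lt_top.ne
    have h2 : t⁻¹ + R = t⁻¹ * (1 + R * t) := by field_simp
    rw [hball _ (by positivity), ← hf t ht, h2, mul_pow, mul_assoc] at h1
    exact le_of_mul_le_mul_left h1 (by positivity)
  have hf0 : f 0 = unitBallVol n * a 0 := by
    simp only [f]
    rw [Finset.sum_eq_single 0] <;> simp +contextual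
  have hcont : Continuous f := by fun_prop
  have hpos : ∀ᶠ t : ℝ in nhdsWithin 0 (Ioi 0), 0 < t := self_mem_nhdsWithin
  have htend := hcont.continuousAt.tendsto.mono_left (nhdsWithin_le_nhds (a := (0 : ℝ)) (s := Ioi 0))
  have h1 : unitBallVol n ≤ f 0 := ge_of_tendsto htend (hpos.mono hlow)
  have h2 : f 0 ≤ (1 + R * 0) ^ n * unitBallVol n := by
    have hc : Continuous fun t : ℝ => (1 + R * t) ^ n * unitBallVol n := by fun_prop
    exact le_of_tendsto_of_tendsto htend
      (hc.continuousAt.tendsto.mono_left nhdsWithin_le_nhds) (hpos.mono hupp)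
  rw [mul_zero, add_zero, one_pow, one_mul] at h2
  rw [hf0] at h1 h2
  have h3 : unitBallVol n * (a 0 : ℝ) = unitBallVol n * 1 := by linarith
  exact_mod_cast mul_left_cancel₀ (unitBallVol_pos n).ne' h3

end Dimension

end Steiner

/-! ## Intrinsic volumes of convex hulls -/

/-- The coefficients of a polynomial of degree at most `d` are fixed linear combinations of its
values at `1, …, d + 1`. -/
theorem exists_coeff_of_eval (d : ℕ) : ∃ l : ℕ → Fin (d + 1) → ℝ, ∀ c : ℕ → ℝ, ∀ k ≤ d,
    c k = ∑ j, l k j * ∑ i ∈ Finset.range (d + 1), c i * ((j : ℕ) + 1 : ℝ) ^ i := by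
  -- The nodes are positive since Steiner's formula concerns `r ≥ 0` and the continuity argument
  -- needs `r > 0`.
  let v : Fin (d + 1) → ℝ := fun j => (j : ℕ) + 1
  have hv : Function.Injective v := fun i j hij => Fin.ext (by simpa [v] using hij)
  have hdet : IsUnit (Matrix.vandermonde v).det :=
    (Matrix.det_vandermonde_ne_zero_iff.2 hv).isUnit
  refine ⟨fun k j => if hk : k < d + 1 then (Matrix.vandermonde v)⁻¹ ⟨k, hk⟩ j else 0,
    fun c k hk => ?_⟩
  have h : ((Matrix.vandermonde v)⁻¹.mulVec
      ((Matrix.vandermonde v).mulVec fun i : Fin (d + 1) => c i)) ⟨k, Nat.lt_succ_of_le hk⟩ = c k := by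
    rw [Matrix.mulVec_mulVec, Matrix.nonsing_inv_mul _ hdet, Matrix.one_mulVec]
  simp only [dif_pos (Nat.lt_succ_of_le hk)]
  rw [← h]
  simp only [Matrix.mulVec, dotProduct, Matrix.vandermonde_apply, v]
  refine Finset.sum_congr rfl fun j _ => ?_
  rw [Finset.sum_range]
  simp only [mul_comm]

theorem IsIntrinsicSeq.reflect {d : ℕ} {K : Set (EucSpace d)} {V : ℕ → ℝ} (h : IsIntrinsicSeq K V)
    {r : ℝ} (hr : 0 ≤ r) : volume.real (K + closedBall (0 : EucSpace d) r) =
      ∑ k ∈ Finset.range (d + 1), (unitBallVol k * V (d - k)) * r ^ k := by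
  rw [h.1 r hr, ← Finset.sum_range_reflect]
  refine Finset.sum_congr rfl fun k hk => ?_
  have hk' : k ≤ d := Nat.lt_succ_iff.1 (Finset.mem_range.1 hk)
  rw [Nat.add_sub_cancel, Nat.sub_sub_self hk']

/-- The coefficients in the two forms of Steiner's formula agree. -/
theorem IsQuermassSeq.eq_intrinsic {d : ℕ} {K : Set (EucSpace d)} {W V : ℕ → ℝ}
    (hW : IsQuermassSeq K W) (hV : IsIntrinsicSeq K V) {k : ℕ} (hk : k ≤ d) :
    W k = unitBallVol k / (d.choose k : ℝ) * V (d - k) := by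
  obtain ⟨l, hl⟩ := exists_coeff_of_eval d
  have h1 := hl (fun k => (d.choose k : ℝ) * W k) k hk
  have h2 := hl (fun k => unitBallVol k * V (d - k)) k hk
  have hpos : ∀ j : Fin (d + 1), (0 : ℝ) ≤ (j : ℕ) + 1 := fun j => by positivity
  simp_rw [← hW.1 _ (hpos _)] at h1
  simp_rw [← hV.reflect (hpos _)] at h2
  have hc : (d.choose k : ℝ) ≠ 0 := by exact_mod_cast (Nat.choose_pos hk).ne'
  rw [div_mul_eq_mul_div, eq_div_iff hc, mul_comm, h1, h2]

theorem IsIntrinsicSeq.isQuermassSeq {d : ℕ} {K : Set (EucSpace d)} {V : ℕ → ℝ}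
    (h : IsIntrinsicSeq K V) : IsQuermassSeq K fun k =>
      if k ≤ d then unitBallVol k / (d.choose k : ℝ) * V (d - k) else 0 := by
  refine ⟨fun r hr => ?_, fun k hk => if_neg hk.not_ge⟩
  rw [h.reflect hr]
  refine Finset.sum_congr rfl fun k hk => ?_
  have hk' : k ≤ d := Nat.lt_succ_iff.1 (Finset.mem_range.1 hk)
  have hc : (d.choose k : ℝ) ≠ 0 := by exact_mod_cast (Nat.choose_pos hk').ne'
  simp only [if_pos hk']
  field_simp

/-- Convert `V` to a quermassintegral sequence and compare it with `V'` at index `d - k`; the common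
factor is non-zero. -/
theorem IsIntrinsicSeq.unique {d : ℕ} {K : Set (EucSpace d)} {V V' : ℕ → ℝ}
    (h : IsIntrinsicSeq K V) (h' : IsIntrinsicSeq K V') : V = V' := by
  funext k
  rcases le_or_gt k d with hk | hk
  · have h1 := h.isQuermassSeq.eq_intrinsic h' (Nat.sub_le d k)
    have hc : ((d.choose (d - k) : ℕ) : ℝ) ≠ 0 := by
      exact_mod_cast (Nat.choose_pos (Nat.sub_le d k)).ne'
    rw [if_pos (Nat.sub_le d k), Nat.sub_sub_self hk] at h1
    exact mul_left_cancel₀ (div_ne_zero (Steiner.unitBallVol_pos _).ne' hc) h1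
  · rw [h.2 k hk, h'.2 k hk]

theorem IsIntrinsicSeq.intrinsicVol_eq {d : ℕ} {K : Set (EucSpace d)} {V : ℕ → ℝ}
    (h : IsIntrinsicSeq K V) : intrinsicVol K = V :=
  (Classical.epsilon_spec (p := IsIntrinsicSeq K) ⟨V, h⟩ : IsIntrinsicSeq K _).unique h

/-! ### Convex hulls of the points: normalization, isometry invariance, continuity -/

section Hull

variable {N d : ℕ}

theorem isCompact_hullOf (p : Fin N → EucSpace d) (I : Finset (Fin N)) :
    IsCompact (hullOf p I) :=
  (I.finite_toSet.image p).isCompact_convexHull ℝ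

theorem hullOf_nonempty (p : Fin N → EucSpace d) {I : Finset (Fin N)} (hI : I.Nonempty) :
    (hullOf p I).Nonempty :=
  convexHull_nonempty_iff.2 ((Finset.coe_nonempty.2 hI).image p)

theorem exists_hasSteinerCoeff_hullOf (p : Fin N → EucSpace d) {I : Finset (Fin N)}
    (hI : I.Nonempty) : ∃ a, Steiner.HasSteinerCoeff (hullOf p I) a := by
  classical
  rw [hullOf, ← Finset.coe_image]
  exact Steiner.exists_hasSteinerCoeff (hI.image p)

theorem Steiner.HasSteinerCoeff.isIntrinsicSeq {K : Set (EucSpace d)} {a : ℕ → ℝ≥0}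
    (h : Steiner.HasSteinerCoeff K a) (hK : IsCompact K) : IsIntrinsicSeq K fun k => (a k : ℝ) := by
  refine ⟨fun r hr => ?_, fun k hk => ?_⟩
  · rw [hK.add_closedBall_zero hr, h.volume_real hr, finrank_euclideanSpace_fin]
  · have := h.2 k (by rwa [finrank_euclideanSpace_fin])
    simp [this]

theorem isIntrinsicSeq_hullOf (p : Fin N → EucSpace d) {I : Finset (Fin N)} (hI : I.Nonempty) :
    IsIntrinsicSeq (hullOf p I) (intrinsicVol (hullOf p I)) := by
  obtain ⟨a, ha⟩ := exists_hasSteinerCoeff_hullOf p hI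
  exact Classical.epsilon_spec (p := IsIntrinsicSeq (hullOf p I))
    ⟨_, ha.isIntrinsicSeq (isCompact_hullOf p I)⟩

theorem quermass_hullOf (p : Fin N → EucSpace d) {I : Finset (Fin N)} (hI : I.Nonempty) {k : ℕ}
    (hk : k ≤ d) : quermass (hullOf p I) k =
      unitBallVol k / (d.choose k : ℝ) * intrinsicVol (hullOf p I) (d - k) := by
  have h := isIntrinsicSeq_hullOf p hI
  exact (Classical.epsilon_spec (p := IsQuermassSeq (hullOf p I))
    ⟨_, h.isQuermassSeq⟩ : IsQuermassSeq _ (quermass _)).eq_intrinsic h hk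

theorem intrinsicVol_hullOf_zero (p : Fin N → EucSpace d) {I : Finset (Fin N)} (hI : I.Nonempty) :
    intrinsicVol (hullOf p I) 0 = 1 := by
  obtain ⟨a, ha⟩ := exists_hasSteinerCoeff_hullOf p hI
  rw [(ha.isIntrinsicSeq (isCompact_hullOf p I)).intrinsicVol_eq]
  simp [ha.apply_zero (isCompact_hullOf p I) (hullOf_nonempty p hI)]

theorem intrinsicVol_hullOf_isometry {d' : ℕ} {Φ : EucSpace d → EucSpace d'} (hΦ : Isometry Φ)
    (p : Fin N → EucSpace d) {I : Finset (Fin N)} (hI : I.Nonempty) :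
    intrinsicVol (hullOf (fun i => Φ (p i)) I) = intrinsicVol (hullOf p I) := by
  -- An isometry into a strictly convex space is automatically affine, so it commutes with convex
  -- hulls and has the form `u ↦ Φ 0 + L u`.
  let A := hΦ.affineIsometryOfStrictConvexSpace
  have hK := isCompact_hullOf p I
  obtain ⟨a, ha⟩ := exists_hasSteinerCoeff_hullOf p hI
  have himage : hullOf (fun i => Φ (p i)) I =
      (fun u => Φ 0 + A.linearIsometry u) '' hullOf p I := by
    have h1 : (fun u => Φ 0 + A.linearIsometry u) = A.toAffineMap := by
      funext u
      have := A.map_vadd 0 u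
      simp only [vadd_eq_add, add_zero] at this
      rw [add_comm]
      exact this.symm
    rw [h1, hullOf, hullOf, AffineMap.image_convexHull, image_image]
    rfl
  have ha' := ha.image hK A.linearIsometry (Φ 0)
  rw [← himage] at ha'
  rw [(ha.isIntrinsicSeq hK).intrinsicVol_eq,
    (ha'.isIntrinsicSeq (isCompact_hullOf _ I)).intrinsicVol_eq]

theorem hullOf_subset_cthickening (p q : Fin N → EucSpace d) (I : Finset (Fin N)) :
    hullOf p I ⊆ cthickening (dist p q) (hullOf q I) := by
  refine convexHull_min ?_ ((convex_convexHull ℝ _).cthickening _)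
  rintro _ ⟨i, hi, rfl⟩
  exact mem_cthickening_of_dist_le _ (q i) _ _
    (subset_convexHull ℝ _ ⟨i, hi, rfl⟩) (dist_le_pi_dist p q i)

/-- Moving the points by at most `δ` moves the hull within its `δ`-neighbourhood. The volume at `p`
is thus squeezed between the Steiner polynomial of the fixed hull at `q` evaluated at `r - δ` and at
`r + δ`. -/
theorem continuous_volume_parallel {I : Finset (Fin N)} (hI : I.Nonempty) {r : ℝ} (hr : 0 < r) :
    Continuous fun p : Fin N → EucSpace d =>
      volume.real (hullOf p I + closedBall (0 : EucSpace d) r) := by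
  rw [continuous_iff_continuousAt]
  intro q
  let f : ℝ → ℝ := fun t => ∑ k ∈ Finset.range (d + 1),
    unitBallVol (d - k) * intrinsicVol (hullOf q I) k * t ^ (d - k)
  have hf : Continuous f := by fun_prop
  have hfv : ∀ t, 0 ≤ t → volume.real (cthickening t (hullOf q I)) = f t := by
    intro t ht
    rw [← (isCompact_hullOf q I).add_closedBall_zero ht]
    exact (isIntrinsicSeq_hullOf q hI).1 t ht
  have hfin : ∀ (p : Fin N → EucSpace d) t, volume (cthickening t (hullOf p I)) ≠ ∞ := fun p t =>
    (isCompact_hullOf p I).isBounded.cthickening.measure_lt_top.ne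
  have hthick : ∀ (p q : Fin N → EucSpace d) {s : ℝ}, 0 ≤ s →
      volume.real (cthickening s (hullOf p I)) ≤
        volume.real (cthickening (s + dist p q) (hullOf q I)) := fun p q s hs =>
    measureReal_mono ((cthickening_subset_of_subset s (hullOf_subset_cthickening p q I)).trans
      (cthickening_cthickening_subset hs dist_nonneg _)) (hfin q _)
  have hd : Filter.Tendsto (fun p => dist p q) (nhds q) (nhds 0) := by
    have : Continuous fun p : Fin N → EucSpace d => dist p q := by fun_prop
    simpa using this.continuousAt (x := q).tendsto
  have hlow : Filter.Tendsto (fun p => f (r - dist p q)) (nhds q) (nhds (f r)) := by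
    have := (hf.tendsto (r - 0)).comp (tendsto_const_nhds.sub hd)
    simpa [Function.comp_def] using this
  have hupp : Filter.Tendsto (fun p => f (r + dist p q)) (nhds q) (nhds (f r)) := by
    have := (hf.tendsto (r + 0)).comp (tendsto_const_nhds.add hd)
    simpa [Function.comp_def] using this
  simp only [(isCompact_hullOf _ I).add_closedBall_zero hr.le]
  rw [ContinuousAt, hfv r hr.le]
  refine tendsto_of_tendsto_of_tendsto_of_le_of_le' hlow hupp ?_ ?_
  -- Near `q` the radius `r - dist p q` stays non-negative, which is where `r > 0` enters.
  · filter_upwards [hd.eventually_lt_const hr] with p hp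
    rw [← hfv _ (sub_nonneg.2 hp.le)]
    have := hthick q p (sub_nonneg.2 hp.le)
    rwa [dist_comm q p, sub_add_cancel] at this
  · refine Filter.Eventually.of_forall fun p => ?_
    rw [← hfv _ (add_nonneg hr.le dist_nonneg)]
    exact hthick p q hr.le

/-- Interpolation writes the coefficient as a combination of parallel volumes at radii `1, …, d +
1`, with weights independent of `p`. -/
theorem continuous_intrinsicVol_hullOf {I : Finset (Fin N)} (hI : I.Nonempty) (k : ℕ) :
    Continuous fun p : Fin N → EucSpace d => intrinsicVol (hullOf p I) k := by
  rcases le_or_gt k d with hk | hk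
  · obtain ⟨l, hl⟩ := exists_coeff_of_eval d
    have hpos : ∀ j : Fin (d + 1), (0 : ℝ) < (j : ℕ) + 1 := fun j => by positivity
    have h : ∀ p : Fin N → EucSpace d, intrinsicVol (hullOf p I) k =
        (unitBallVol (d - k))⁻¹ * ∑ j : Fin (d + 1), l (d - k) j *
          volume.real (hullOf p I + closedBall (0 : EucSpace d) ((j : ℕ) + 1)) := by
      intro p
      simp_rw [(isIntrinsicSeq_hullOf p hI).reflect (hpos _).le]
      rw [← hl (fun k => unitBallVol k * intrinsicVol (hullOf p I) (d - k)) (d - k) (Nat.sub_le d k),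
        Nat.sub_sub_self hk, inv_mul_cancel_left₀ (Steiner.unitBallVol_pos _).ne']
    simp_rw [h]
    exact continuous_const.mul (continuous_finsetSum _ fun j _ =>
      continuous_const.mul (continuous_volume_parallel hI (hpos j)))
  · simp_rw [fun p : Fin N → EucSpace d => (isIntrinsicSeq_hullOf p hI).2 k hk]
    exact continuous_const

end Hull

/-! ## Zero-weight extensions of linear combinations -/

namespace FreeBoolAlg

variable {N : ℕ}

theorem unionCoeff_spec (hN : 1 ≤ N) {f : FreeBoolAlg N} (hf : InC f) :
    IsUnionCoeff f (unionCoeff f) :=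
  Classical.epsilon_spec (existsUnique_unionCoeff hN hf).exists

/-- The sum of the two families satisfies the identity defining the coefficients of `f ∪ g`, so
uniqueness applies. This makes every combination with these coefficients additive on `C_N`. -/
theorem unionCoeff_union (hN : 1 ≤ N) {f g : FreeBoolAlg N} (hf : InC f) (hg : InC g)
    (hfg : f ∩ g = ∅) : unionCoeff (f ∪ g) = unionCoeff f + unionCoeff g := by
  refine (existsUnique_unionCoeff hN (hf.union hg)).unique (unionCoeff_spec hN (hf.union hg))
    fun μ hμ => ?_
  rw [hμ f g hf hg hfg, unionCoeff_spec hN hf μ hμ, unionCoeff_spec hN hg μ hμ,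
    ← Finset.sum_add_distrib]
  refine Finset.sum_congr rfl fun I _ => ?_
  rw [Pi.add_apply, Int.cast_add, add_mul]

theorem isZeroWeightExt_sum (hN : 1 ≤ N) (b : NonemptySub N → ℝ) :
    IsZeroWeightExt (fun g => ∑ I, (unionCoeff g I : ℝ) * b I)
      (zeroWeightExt fun g => ∑ I, (unionCoeff g I : ℝ) * b I) := by
  refine Classical.epsilon_spec (existsUnique_zeroWeightExt hN fun f g hf hg hfg => ?_).exists
  rw [← Finset.sum_add_distrib]
  refine Finset.sum_congr rfl fun I _ => ?_
  rw [unionCoeff_union hN hf hg hfg, Pi.add_apply, Int.cast_add, add_mul]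

theorem unionCoeff_empty (hN : 1 ≤ N) : unionCoeff (∅ : FreeBoolAlg N) = 0 := by
  have h := unionCoeff_union hN (inC_empty hN) (inC_empty hN) (inter_self ∅)
  rw [union_self] at h
  exact left_eq_add.1 h

theorem zeroWeightExt_sum_empty (hN : 1 ≤ N) (b : NonemptySub N → ℝ) :
    zeroWeightExt (fun g => ∑ I, (unionCoeff g I : ℝ) * b I) ∅ = 0 := by
  rw [(isZeroWeightExt_sum hN b).1 _ (inC_empty hN)]
  simp [unionCoeff_empty hN]

theorem zeroWeightExt_sum_union (hN : 1 ≤ N) (b : NonemptySub N → ℝ) {f g : FreeBoolAlg N}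
    (hfg : f ∩ g = ∅) : zeroWeightExt (fun g => ∑ I, (unionCoeff g I : ℝ) * b I) (f ∪ g) =
      zeroWeightExt (fun g => ∑ I, (unionCoeff g I : ℝ) * b I) f +
        zeroWeightExt (fun g => ∑ I, (unionCoeff g I : ℝ) * b I) g := by
  rw [(isZeroWeightExt_sum hN b).2.1 f g, hfg, zeroWeightExt_sum_empty hN, sub_zero]

/-- Additivity on the partition of the top element into `f` and `fᶜ`, together with weight `0` at
the top. -/
theorem zeroWeightExt_sum_compl (hN : 1 ≤ N) (b : NonemptySub N → ℝ) (f : FreeBoolAlg N) :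
    zeroWeightExt (fun g => ∑ I, (unionCoeff g I : ℝ) * b I) fᶜ =
      -zeroWeightExt (fun g => ∑ I, (unionCoeff g I : ℝ) * b I) f := by
  have h := zeroWeightExt_sum_union hN b (inter_compl_self f)
  rw [union_compl_self, (isZeroWeightExt_sum hN b).2.2] at h
  linarith

open Classical in
/-- The coefficients of the `0`-weight extension: `m_{f,I}` for `f ∈ C_N`, and `-m_{fᶜ,I}`
otherwise. -/
noncomputable def extCoeff (f : FreeBoolAlg N) (I : NonemptySub N) : ℝ :=
  if InC f then (unionCoeff f I : ℝ) else -(unionCoeff fᶜ I : ℝ)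

theorem inC_compl (hN : 1 ≤ N) {f : FreeBoolAlg N} (hf : ¬ InC f) : InC fᶜ := by
  refine inC_of_empty_notMem hN fun h => hf (inC_of_empty_notMem hN h)

theorem zeroWeightExt_sum (hN : 1 ≤ N) (b : NonemptySub N → ℝ) (f : FreeBoolAlg N) :
    zeroWeightExt (fun g => ∑ I, (unionCoeff g I : ℝ) * b I) f = ∑ I, extCoeff f I * b I := by
  by_cases hf : InC f
  · simp only [extCoeff, if_pos hf]
    exact (isZeroWeightExt_sum hN b).1 f hf
  · simp only [extCoeff, if_neg hf]
    rw [← compl_compl f, zeroWeightExt_sum_compl hN, compl_compl,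
      (isZeroWeightExt_sum hN b).1 _ (inC_compl hN hf), ← Finset.sum_neg_distrib]
    simp only [neg_mul]

theorem univ_mem_iff_atom_subset {f : FreeBoolAlg N} :
    atom ∅ ⊆ f ↔ (Finset.univ : Finset (Fin N)) ∈ f := by
  have h : atom (∅ : Finset (Fin N)) = {Finset.univ} := by
    ext T
    rw [mem_atom, mem_singleton_iff, Finset.compl_empty]
  rw [h, singleton_subset_iff]

-- The point mass at the all-true assignment is additive and has value `1` on every `u_I`. The
-- defining identity then equates the sum of the coefficients with its value at `f`, and `atom ∅`
-- consists of that assignment alone.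
open Classical in
theorem sum_unionCoeff (hN : 1 ≤ N) {f : FreeBoolAlg N} (hf : InC f) :
    ∑ I, (unionCoeff f I : ℝ) = if atom ∅ ⊆ f then 1 else 0 := by
  have h := unionCoeff_spec hN hf _ (additiveOnC_dirac Finset.univ)
  have hu : ∀ I : NonemptySub N, (Finset.univ : Finset (Fin N)) ∈ unionVar I.1 := by
    intro I
    obtain ⟨i, hi⟩ := I.2
    exact mem_unionVar.2 (Finset.not_disjoint_iff.2 ⟨i, hi, Finset.mem_univ i⟩)
  simp only [indicator_of_mem (hu _), mul_one] at h
  rw [← h, indicator_apply]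
  simp only [univ_mem_iff_atom_subset]

open Classical in
theorem sum_extCoeff (hN : 1 ≤ N) {f : FreeBoolAlg N} (hf : ¬ InC f) :
    ∑ I, extCoeff f I = if atom ∅ ⊆ f then 0 else -1 := by
  simp only [extCoeff, if_neg hf]
  rw [Finset.sum_neg_distrib, sum_unionCoeff hN (inC_compl hN hf)]
  simp only [univ_mem_iff_atom_subset, mem_compl_iff]
  split_ifs <;> simp_all

end FreeBoolAlg

/-! ### Boolean intrinsic volumes and quermassintegrals -/

theorem boolIntrinsicVol_eq_sum {N d : ℕ} (hN : 1 ≤ N) (f : FreeBoolAlg N) (k : ℕ)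
    (p : Fin N → EucSpace d) : boolIntrinsicVol f k p =
      ∑ I : FreeBoolAlg.NonemptySub N, f.extCoeff I * intrinsicVol (hullOf p I.1) k :=
  FreeBoolAlg.zeroWeightExt_sum hN (fun I => intrinsicVol (hullOf p I.1) k) f

theorem boolIntrinsicVol_zero {N d : ℕ} (hN : 1 ≤ N) (f : FreeBoolAlg N)
    (p : Fin N → EucSpace d) :
    boolIntrinsicVol f 0 p = ∑ I : FreeBoolAlg.NonemptySub N, f.extCoeff I := by
  rw [boolIntrinsicVol_eq_sum hN]
  exact Finset.sum_congr rfl fun I _ => by rw [intrinsicVol_hullOf_zero p I.2, mul_one]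

theorem boolIntrinsicVol_isometry {N d d' : ℕ} (hN : 1 ≤ N) (f : FreeBoolAlg N) (k : ℕ)
    {Φ : EucSpace d → EucSpace d'} (hΦ : Isometry Φ) (p : Fin N → EucSpace d) :
    boolIntrinsicVol f k (fun i => Φ (p i)) = boolIntrinsicVol f k p := by
  simp_rw [boolIntrinsicVol_eq_sum hN]
  exact Finset.sum_congr rfl fun I _ => by rw [intrinsicVol_hullOf_isometry hΦ p I.2]

theorem boolQuermass_eq {N d : ℕ} (hN : 1 ≤ N) (f : FreeBoolAlg N) {k : ℕ} (hk : k ≤ d)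
    (p : Fin N → EucSpace d) : boolQuermass f k p =
      unitBallVol k / (d.choose k : ℝ) * boolIntrinsicVol f (d - k) p := by
  have h : boolQuermass f k p =
      ∑ I : FreeBoolAlg.NonemptySub N, f.extCoeff I * quermass (hullOf p I.1) k :=
    FreeBoolAlg.zeroWeightExt_sum hN (fun I => quermass (hullOf p I.1) k) f
  rw [h, boolIntrinsicVol_eq_sum hN, Finset.mul_sum]
  exact Finset.sum_congr rfl fun I _ => by rw [quermass_hullOf p I.2 hk, mul_left_comm]

/-- `(d + s choose k + s) / (d choose k) = ((d + 1) ⋯ (d + s)) / ((k + 1) ⋯ (k + s))`. -/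
theorem choose_add_mul_prod (d k s : ℕ) :
    ((d + s).choose (k + s) : ℝ) * ∏ j ∈ Finset.Icc 1 s, ((k : ℝ) + j) =
      (d.choose k : ℝ) * ∏ j ∈ Finset.Icc 1 s, ((d : ℝ) + j) := by
  induction s with
  | zero => simp
  | succ s ih =>
    have h : ((d + s + 1 : ℕ) : ℝ) * ((d + s).choose (k + s) : ℝ) =
        ((d + s + 1).choose (k + s + 1) : ℝ) * ((k + s + 1 : ℕ) : ℝ) := by
      exact_mod_cast Nat.add_one_mul_choose_eq (d + s) (k + s)
    rw [Finset.prod_Icc_succ_top (by omega), Finset.prod_Icc_succ_top (by omega), ← mul_assoc,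
      ← mul_assoc, ← ih, ← add_assoc, ← add_assoc]
    push_cast at h ⊢
    linear_combination -(∏ j ∈ Finset.Icc 1 s, ((k : ℝ) + j)) * h

open Classical in
theorem proposition5p1 (N : ℕ) (hN : 1 ≤ N) :
    -- `V_{f,0}` does not depend on `p`, and its value
    (∀ (f : FreeBoolAlg N) (d : ℕ) (p q : Fin N → EucSpace d),
      boolIntrinsicVol f 0 p = boolIntrinsicVol f 0 q) ∧
    (∀ (f : FreeBoolAlg N) (d : ℕ) (p : Fin N → EucSpace d), f.InC →
      boolIntrinsicVol f 0 p = ∑ I : FreeBoolAlg.NonemptySub N, (f.unionCoeff I : ℝ) ∧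
      boolIntrinsicVol f 0 p = if FreeBoolAlg.atom ∅ ⊆ f then 1 else 0) ∧
    (∀ (f : FreeBoolAlg N) (d : ℕ) (p : Fin N → EucSpace d), ¬ f.InC →
      boolIntrinsicVol f 0 p = if FreeBoolAlg.atom ∅ ⊆ f then 0 else -1) ∧
    -- independence of the ambient dimension, and the relations between `W` and `V`
    (∀ (f : FreeBoolAlg N) (k d d' : ℕ) (Φ : EucSpace d → EucSpace d'), Isometry Φ →
      ∀ p : Fin N → EucSpace d,
        boolIntrinsicVol f k (fun i => Φ (p i)) = boolIntrinsicVol f k p) ∧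
    (∀ (f : FreeBoolAlg N) (d k s : ℕ), k ≤ d →
      ∀ (Φ : EucSpace d → EucSpace (d + s)), Isometry Φ → ∀ p : Fin N → EucSpace d,
        boolQuermass f k p =
          unitBallVol k / (d.choose k : ℝ) * boolIntrinsicVol f (d - k) p ∧
        unitBallVol k / (d.choose k : ℝ) * boolIntrinsicVol f (d - k) p =
          unitBallVol k / (d.choose k : ℝ) *
            boolIntrinsicVol f ((d + s) - (k + s)) (fun i => Φ (p i)) ∧
        unitBallVol k / (d.choose k : ℝ) *
            boolIntrinsicVol f ((d + s) - (k + s)) (fun i => Φ (p i)) =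
          ((d + s).choose (k + s) : ℝ) * unitBallVol k /
              ((d.choose k : ℝ) * unitBallVol (k + s)) *
            boolQuermass f (k + s) (fun i => Φ (p i)) ∧
        ((d + s).choose (k + s) : ℝ) * unitBallVol k /
              ((d.choose k : ℝ) * unitBallVol (k + s)) *
            boolQuermass f (k + s) (fun i => Φ (p i)) =
          (∏ j ∈ Finset.Icc 1 s, ((d : ℝ) + j)) * unitBallVol k /
              ((∏ j ∈ Finset.Icc 1 s, ((k : ℝ) + j)) * unitBallVol (k + s)) *
            boolQuermass f (k + s) (fun i => Φ (p i))) ∧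
    -- continuity
    (∀ (f : FreeBoolAlg N) (k d : ℕ),
      Continuous fun p : Fin N → EucSpace d => boolIntrinsicVol f k p) ∧
    -- additivity
    (∀ (f g : FreeBoolAlg N), f ∩ g = ∅ → ∀ (k d : ℕ) (p : Fin N → EucSpace d),
      boolQuermass (f ∪ g) k p = boolQuermass f k p + boolQuermass g k p ∧
      boolIntrinsicVol (f ∪ g) k p = boolIntrinsicVol f k p + boolIntrinsicVol g k p) ∧
    -- complements
    (∀ (f : FreeBoolAlg N) (k d : ℕ) (p : Fin N → EucSpace d),
      boolQuermass fᶜ k p = - boolQuermass f k p ∧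
      boolIntrinsicVol fᶜ k p = - boolIntrinsicVol f k p) := by
  refine ⟨fun f d p q => ?_, fun f d p hf => ?_, fun f d p hf => ?_,
    fun f k d d' Φ hΦ p => boolIntrinsicVol_isometry hN f k hΦ p,
    fun f d k s hk Φ hΦ p => ⟨boolQuermass_eq hN f hk p, ?_, ?_, ?_⟩, fun f k d => ?_,
    fun f g hfg k d p => ⟨?_, ?_⟩, fun f k d p => ⟨?_, ?_⟩⟩
  · rw [boolIntrinsicVol_zero hN, boolIntrinsicVol_zero hN]
  · have h : boolIntrinsicVol f 0 p = ∑ I : FreeBoolAlg.NonemptySub N, (f.unionCoeff I : ℝ) := by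
      rw [boolIntrinsicVol_zero hN]
      simp only [FreeBoolAlg.extCoeff, if_pos hf]
    exact ⟨h, h.trans (FreeBoolAlg.sum_unionCoeff hN hf)⟩
  · rw [boolIntrinsicVol_zero hN, FreeBoolAlg.sum_extCoeff hN hf]
  · rw [boolIntrinsicVol_isometry hN f _ hΦ p, Nat.add_sub_add_right]
  · have hc : ((d + s).choose (k + s) : ℝ) ≠ 0 := by
      exact_mod_cast (Nat.choose_pos (Nat.add_le_add_right hk s)).ne'
    have hc' : (d.choose k : ℝ) ≠ 0 := by exact_mod_cast (Nat.choose_pos hk).ne'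
    have hv := (Steiner.unitBallVol_pos (k + s)).ne'
    -- The same relation between `W` and `V`, now in dimension `d + s` at index `k + s`; the
    -- binomial and ball factors there cancel.
    rw [boolQuermass_eq hN f (Nat.add_le_add_right hk s)]
    field_simp
  · have hc : (d.choose k : ℝ) ≠ 0 := by exact_mod_cast (Nat.choose_pos hk).ne'
    have hv := (Steiner.unitBallVol_pos (k + s)).ne'
    have hp : (∏ j ∈ Finset.Icc 1 s, ((k : ℝ) + j)) ≠ 0 :=
      Finset.prod_ne_zero_iff.2 fun j hj => by
        have : (0 : ℝ) < j := by exact_mod_cast (Finset.mem_Icc.1 hj).1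
        positivity
    congr 1
    rw [div_eq_div_iff (mul_ne_zero hc hv) (mul_ne_zero hp hv)]
    linear_combination unitBallVol k * unitBallVol (k + s) * choose_add_mul_prod d k s
  · simp_rw [boolIntrinsicVol_eq_sum hN]
    exact continuous_finsetSum _ fun I _ =>
      continuous_const.mul (continuous_intrinsicVol_hullOf I.2 k)
  -- Additivity and complements hold for arbitrary values attached to the hulls, hence for every
  -- `k`, including `k > d`.
  · exact FreeBoolAlg.zeroWeightExt_sum_union hN (fun I => quermass (hullOf p I.1) k) hfg
  · exact FreeBoolAlg.zeroWeightExt_sum_union hN (fun I => intrinsicVol (hullOf p I.1) k) hfg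
  · exact FreeBoolAlg.zeroWeightExt_sum_compl hN (fun I => quermass (hullOf p I.1) k) f
  · exact FreeBoolAlg.zeroWeightExt_sum_compl hN (fun I => intrinsicVol (hullOf p I.1) k) f
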